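/- **Problem.** Let $f:\mathbb R^n\times\mathbb R^m\to\mathbb R^n$, $g:\mathbb R^n\times\mathbb R^m\to\mathbb R$, let $\Omega\subset\mathbb R^m$ be bounded, $X_{\rm free},X_{\rm goal}\subset\mathbb R^n$, $x_{\rm ic}\in\mathbb R^n$. Let $\mathcal U$ be the set of integrable $u:[0,\tau(u)]\to\Omega$ with $\tau(u)>0$. Let $\varphi_{x_0}(u)$ be the solution on $[0,\tau(u)]$ of $\dot x=f(x,u)$, $x(0)=x_0$ (that is, $x(t)=x_0+\int_0^t f(x,u)\,ds$), and $J_{x_0}(u)=\int_0^{\tau(u)}g([\varphi_{x_0}(u)](t),u(t))\,dt$. Let $\mathcal U_{\rm feas}$ be the set of $u\in\mathcal U$ whose trajectory $\varphi_{x_{\rm ic}}(u)$ exists and stays in $X_{\rm free}$, and $\mathcal U_{\rm goal}$ the set of $u\in\mathcal U_{\rm feas}$ whose trajectory ends in $X_{\rm goal}$. Put $J_{x_{\rm ic}}(\mathtt{NULL})=\infty$ and $c^*=\inf_{u\in\mathcal U_{\rm goal}}J_{x_{\rm ic}}(u)$, with $\inf\emptyset=\infty$. **Assumptions.** For each $x\in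 X_{\rm free}$ the map $f(x,\cdot)$ is continuous on $\Omega$, and: - (A-1) $X_{\rm free}$ and $X_{\rm goal}$ are open. - (A-2) There are constants $L_f,M\ge0$ with $\|f(x_1,u)-f(x_2,u)\|_2\le L_f\|x_1-x_2\|_2$ and $\|f(x_1,u)\|_2\le M$ for $x_1,x_2\in X_{\rm free}$, $u\in\Omega$. - (A-3) There is a constant $L_g\ge0$ with $|g(x_1,u_1)-g(x_2,u_2)|\le L_g\|(x_1-x_2,u_1-u_2)\|_2$ for $x_1,x_2\in X_{\rm free}$, $u_1,u_2\in\Omega$. - (A-4) $J_{x_{\rm ic}}(u)>0$ for all $u\in\mathcal U_{\rm feas}$, and the cost does not decrease when a signal is extended in time: $J_{x_{\rm ic}}(u|_{[0,s]})\le J_{x_{\rm ic}}(u)$ for $u\in\mathcal U_{\rm feas}$, $0<s\le\tau(u)$. **Discretization.** For $R\in\mathbb N$, $R\ge1$, let $\Omega_R\subset\Omega$ be finite sets whose dispersion in $\Omega$ tends to $0$ as $R\to\infty$, let $c>0$, and let $h:\mathbb N\to\mathbb N$ and $\eta:\mathbb N\to\mathbb R_{>0}$ satisfy, with $h(R)>0$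 for large $R$, $$\lim_{R\to\infty}\frac R{h(R)}=0,\qquad \lim_{R\to\infty}\frac{R}{L_f\,\eta(R)}\left(e^{L_fh(R)/R}-1\right)=0 .$$ Here and below $(e^{L_ft}-1)/L_f$ means $t$ if $L_f=0$. For $d\ge1$, a signal of depth $d$ has duration $cd/R$ and is constant with value in $\Omega_R$ on each interval $[c(i-1)/R,ci/R)$, $1\le i\le d$ (the last one closed). The root $Id$ has depth $0$, duration $0$, cost $0$ and end state $x_{\rm ic}$, and it is not in $\mathcal U_{\rm goal}$. The children of a signal of depth $d$ are the signals of depth $d+1$ that extend it. Write $u_1\sim_R u_2$ if the end states $p_1,p_2$ of their trajectories from $x_{\rm ic}$ satisfy $\lfloor\eta(R)p_1\rfloor=\lfloor\eta(R)p_2\rfloor$ coordinatewise, and $u_1\prec_R u_2$ if $u_1\sim_R u_2$, $\tau(u_1)\le\tau(u_2)$ and $$J_{x_{\rm ic}}(u_1)+\frac{\sqrt n}{\eta(R)}\frac{L_g}{L_f}\left(e^{L_fh(R)/R}-1\right)\le J_{x_{\rm ic}}(u_2).$$ **GLC method at resolution $R$.** Start with $Q=\{Id\}$, $\Sigma=\emptyset$.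 While $Q\ne\emptyset$: remove from $Q$ some $u$ of least cost $J_{x_{\rm ic}}(u)$ in $Q$; if $u\in\mathcal U_{\rm goal}$, return $u$; otherwise let $S$ be the set of children of $u$ and examine these children $w$ one after the other: let $z\in\Sigma$ with $w\sim_R z$ ($z=\mathtt{NULL}$ if there is none); if $w\notin\mathcal U_{\rm feas}$, or $z\prec_R w$, or the depth of $w$ is at least $h(R)$, remove $w$ from $S$; otherwise, if $J_{x_{\rm ic}}(w)<J_{x_{\rm ic}}(z)$, replace $\Sigma$ by $(\Sigma\setminus\{z\})\cup\{w\}$. After that, replace $Q$ by $Q\cup S$. If $Q=\emptyset$, return $\mathtt{NULL}$. **Theorem.** For each $R\ge1$ every run of the method terminates, whatever the order in which children are examined and whatever the choice among elements of least cost. If $w_R$ is, for each $R\ge1$, the output of any such run, then $w_R\in\mathcal U_{\rm goal}\cup\{\mathtt{NULL}\}$ and $\lim_{R\to\infty}J_{x_{\rm ic}}(w_R)=c^*$; that is, the GLC method is resolution complete. -/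

import Mathlib

namespace GLC

open MeasureTheory Set Filter Topology

noncomputable section

/-- `ℝᵈ` with the Euclidean norm. -/
abbrev E (d : ℕ) := EuclideanSpace ℝ (Fin d)

/-- The data of an optimal kinodynamic motion planning problem: dynamics `x' = f(x, u)`, running
cost `g`, admissible inputs `Ω`, state constraint `Xfree`, terminal constraint `Xgoal`, and initial
state `xic`. -/
structure Problem (n m : ℕ) where
  f : E n → E m → E n
  g : E n → E m → ℝ
  Ω : Set (E m)
  Xfree : Set (E n)
  Xgoal : Set (E n)
  xic : E n

/-- A function on `[0, dur]`; the values of `val` outside `[0, dur]` play no role. -/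
structure Signal (m : ℕ) where
  dur : ℝ
  val : ℝ → E m

variable {n m : ℕ}

/-- The restriction of a signal to `[0, s]`. -/
def Signal.trunc (u : Signal m) (s : ℝ) : Signal m := ⟨s, u.val⟩

/-- The signal space `𝒰`: integrable functions on some `[0, τ]`, `τ > 0`, with values in `Ω`. -/
def SignalSpace (Ω : Set (E m)) : Set (Signal m) :=
  {u | 0 < u.dur ∧ IntegrableOn u.val (Icc 0 u.dur) ∧ ∀ t ∈ Icc 0 u.dur, u.val t ∈ Ω}

namespace Problem

variable (P : Problem n m)

/-- `x` is a (Carathéodory) solution on `[0, dur u]` of `x' = f(x, u)`, `x(0) = x₀`. -/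
def IsTrajectory (x₀ : E n) (u : Signal m) (x : ℝ → E n) : Prop :=
  ContinuousOn x (Icc 0 u.dur) ∧
  IntervalIntegrable (fun s => P.f (x s) (u.val s)) volume 0 u.dur ∧
  ∀ t ∈ Icc 0 u.dur, x t = x₀ + ∫ s in (0 : ℝ)..t, P.f (x s) (u.val s)

open scoped Classical in
/-- The system map `φ_{x₀}` (a constant function when there is no trajectory). -/
def sysMap (x₀ : E n) (u : Signal m) : ℝ → E n :=
  if h : ∃ x, P.IsTrajectory x₀ u x then h.choose else fun _ => x₀

/-- The cost functional `J_{x₀}(u)`. -/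
def J (x₀ : E n) (u : Signal m) : ℝ :=
  ∫ t in (0 : ℝ)..u.dur, P.g (P.sysMap x₀ u t) (u.val t)

/-- `𝒰_feas`: the signals whose trajectory from `xic` exists and stays in `Xfree`. -/
def Ufeas : Set (Signal m) :=
  {u | u ∈ SignalSpace P.Ω ∧ (∃ x, P.IsTrajectory P.xic u x) ∧
    ∀ t ∈ Icc 0 u.dur, P.sysMap P.xic u t ∈ P.Xfree}

/-- `𝒰_goal`: the feasible signals whose trajectory ends in `Xgoal`. -/
def Ugoal : Set (Signal m) :=
  {u | u ∈ P.Ufeas ∧ P.sysMap P.xic u u.dur ∈ P.Xgoal}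

/-- The cost `J_{xic}` extended to `NULL` (`none`) by `J(NULL) = ∞`. -/
def cost : Option (Signal m) → EReal
  | none => ⊤
  | some u => (P.J P.xic u : EReal)

/-- The optimal cost `c*`, equal to `∞` when `𝒰_goal` is empty. -/
def cstar : EReal := ⨅ u ∈ P.Ugoal, (P.J P.xic u : EReal)

/-- A sequence (indexed by resolutions `R ≥ 1`) in `𝒰_goal ∪ {NULL}` whose costs converge to
`c*`. -/
def IsSolutionSequence (w : ℕ → Option (Signal m)) : Prop :=
  (∀ R, 0 < R → ∀ u, w R = some u → u ∈ P.Ugoal) ∧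
  Tendsto (fun R => P.cost (w R)) atTop (𝓝 P.cstar)

end Problem

/-- The parameters of the method: the Lipschitz constants `Lf`, `Lg` that it knows, the time-step
constant `c` (time steps are `c / R`), the finite input sets `Ω_R`, the horizon limit `h`, and the
partition scaling `η`. -/
structure Params (m : ℕ) where
  Lf : ℝ
  Lg : ℝ
  c : ℝ
  inputs : ℕ → Finset (E m)
  h : ℕ → ℕ
  η : ℕ → ℝ

/-- `(e^{L t} - 1) / L`, read as its limit `t` when `L = 0`. -/
def expQuot (L t : ℝ) : ℝ := if L = 0 then t else (Real.exp (L * t) - 1) / L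

/-- A node of the search tree: the list of successive constant inputs of a piecewise constant
signal. The empty list is the root `Id`; the length is the depth. -/
abbrev Node (m : ℕ) := List (E m)

/-- The signal of duration `c d / R` that equals the `i`-th of `d` inputs on
`[c (i - 1) / R, c i / R)`, the last interval being closed. -/
def Params.toSignal (D : Params m) (R : ℕ) (w : Node m) : Signal m where
  dur := D.c * w.length / R
  val := fun t => w.getD (min ⌊t * R / D.c⌋₊ (w.length - 1)) 0

section Algorithm

variable (P : Problem n m) (D : Params m) (R : ℕ)

/-- `J_{xic}` of a node. -/
def nodeJ (w : Node m) : ℝ := P.J P.xic (D.toSignal R w)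

/-- `J_{xic}` of a node or `NULL`. -/
def nodeCost (z : Option (Node m)) : EReal := P.cost (z.map (D.toSignal R))

/-- The state in which the trajectory of a node ends. -/
def endState (w : Node m) : E n :=
  P.sysMap P.xic (D.toSignal R w) (D.toSignal R w).dur

/-- Two nodes are equivalent if their trajectories end in the same cell of the partition into
hypercubes. -/
def Equivalent (u w : Node m) : Prop :=
  ∀ i : Fin n, ⌊D.η R * endState P D R u i⌋ = ⌊D.η R * endState P D R w i⌋

/-- The GLC conditions `u ≺_R w`. -/
def Prec (u w : Node m) : Prop :=
  Equivalent P D R u w ∧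
  (D.toSignal R u).dur ≤ (D.toSignal R w).dur ∧
  nodeJ P D R u + Real.sqrt n / D.η R * (D.Lg * expQuot D.Lf ((D.h R : ℝ) / R)) ≤ nodeJ P D R w

open scoped Classical in
/-- `expand(u)`: the children of a node. -/
def expand (u : Node m) : Finset (Node m) := (D.inputs R).image (fun v => u ++ [v])

/-- `z` is a possible result of `find(w, Σ)`. -/
def IsFind (w : Node m) (labels : Finset (Node m)) : Option (Node m) → Prop
  | none => ∀ y ∈ labels, ¬ Equivalent P D R w y
  | some z => z ∈ labels ∧ Equivalent P D R w z

/-- The test for removing the child `w` when `find` has returned `z`: infeasibility, pruning by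
the GLC conditions, or the horizon limit. -/
def Discard (w : Node m) (z : Option (Node m)) : Prop :=
  D.toSignal R w ∉ P.Ufeas ∨ (∃ y, z = some y ∧ Prec P D R y w) ∨ D.h R ≤ w.length

open scoped Classical in
/-- One pass of the inner loop for the child `w`, on the pair `(S, Σ)`. -/
def Examine (w : Node m) (s s' : Finset (Node m) × Finset (Node m)) : Prop :=
  ∃ z, IsFind P D R w s.2 z ∧
    ((Discard P D R w z ∧ s' = (s.1.erase w, s.2)) ∨
     (¬ Discard P D R w z ∧ (nodeJ P D R w : EReal) < nodeCost P D R z ∧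
        s' = (s.1, insert w (s.2 \ z.toFinset))) ∨
     (¬ Discard P D R w z ∧ ¬ (nodeJ P D R w : EReal) < nodeCost P D R z ∧ s' = s))

/-- The inner loop over the children in the order in which they are listed. -/
def ForLoop : List (Node m) → Finset (Node m) × Finset (Node m) →
    Finset (Node m) × Finset (Node m) → Prop
  | [], s, s' => s' = s
  | w :: l, s, s' => ∃ s₁, Examine P D R w s s₁ ∧ ForLoop l s₁ s'

/-- `u` is a possible result of `pop(Q)`: an element of `Q` of least cost. -/
def IsPop (Q : Finset (Node m)) (u : Node m) : Prop :=
  u ∈ Q ∧ ∀ v ∈ Q, nodeJ P D R u ≤ nodeJ P D R v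

/-- The state `(Q, Σ)` at the start of a pass of the outer loop. -/
abbrev LoopState (m : ℕ) := Finset (Node m) × Finset (Node m)

/-- The initial state `({Id}, ∅)`. -/
def initState : LoopState m := ({[]}, ∅)

open scoped Classical in
/-- A pass of the outer loop that does not return. The children are examined in an arbitrary
order `l`. -/
def Step (s s' : LoopState m) : Prop :=
  ∃ u, IsPop P D R s.1 u ∧ D.toSignal R u ∉ P.Ugoal ∧
    ∃ l : List (Node m), (l : Multiset (Node m)) = (expand D R u).val ∧
      ∃ S : Finset (Node m),
        ForLoop P D R l (expand D R u, s.2) (S, s'.2) ∧ s'.1 = s.1.erase u ∪ S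

/-- The algorithm returns `w` from the state `s`: a popped node in `𝒰_goal`, or `NULL` if the
queue is empty. -/
def Returns (s : LoopState m) : Option (Node m) → Prop
  | none => s.1 = ∅
  | some u => IsPop P D R s.1 u ∧ D.toSignal R u ∈ P.Ugoal

/-- `s` occurs in some run of the algorithm. -/
def Reachable (s : LoopState m) : Prop :=
  Relation.ReflTransGen (Step P D R) initState s

/-- `w` is the output of some run of the algorithm at resolution `R`. -/
def IsOutput (w : Option (Signal m)) : Prop :=
  ∃ s z, Reachable P D R s ∧ Returns P D R s z ∧ w = z.map (D.toSignal R)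

/-- At resolution `R` every run is finite and ends by returning an output: there is no infinite
run, and no run gets stuck. -/
def AlwaysTerminates : Prop :=
  (¬ ∃ s : ℕ → LoopState m, s 0 = initState ∧ ∀ k, Step P D R (s k) (s (k + 1))) ∧
  ∀ s, Reachable P D R s → (∃ s', Step P D R s s') ∨ ∃ z, Returns P D R s z

end Algorithm

/-- Assumption A-1. -/
def Problem.OpenConstraints (P : Problem n m) : Prop := IsOpen P.Xfree ∧ IsOpen P.Xgoal

/-- Assumption A-2. -/
def Problem.DynamicsBounds (P : Problem n m) (Lf M : ℝ) : Prop :=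
  (∀ x₁ ∈ P.Xfree, ∀ x₂ ∈ P.Xfree, ∀ u ∈ P.Ω, ‖P.f x₁ u - P.f x₂ u‖ ≤ Lf * ‖x₁ - x₂‖) ∧
  ∀ x ∈ P.Xfree, ∀ u ∈ P.Ω, ‖P.f x u‖ ≤ M

/-- Assumption A-3, with the Euclidean norm on `ℝⁿ × ℝᵐ`. -/
def Problem.CostLipschitz (P : Problem n m) (Lg : ℝ) : Prop :=
  ∀ x₁ ∈ P.Xfree, ∀ x₂ ∈ P.Xfree, ∀ u₁ ∈ P.Ω, ∀ u₂ ∈ P.Ω,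
    |P.g x₁ u₁ - P.g x₂ u₂| ≤ Lg * Real.sqrt (‖x₁ - x₂‖ ^ 2 + ‖u₁ - u₂‖ ^ 2)

/-- Assumption A-4: the cost of a signal is positive, and it does not decrease when a signal is
extended in time. -/
def Problem.PositiveCost (P : Problem n m) : Prop :=
  (∀ u ∈ P.Ufeas, 0 < P.J P.xic u) ∧
  ∀ u ∈ P.Ufeas, ∀ s ∈ Ioc 0 u.dur, P.J P.xic (u.trunc s) ≤ P.J P.xic u

/-- The sets `Ω_R` are subsets of `Ω` whose dispersion in `Ω` converges to zero. -/
def InputsDense (Ω : Set (E m)) (inputs : ℕ → Finset (E m)) : Prop :=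
  (∀ R, (inputs R : Set (E m)) ⊆ Ω) ∧
  ∀ ε > 0, ∀ᶠ R in atTop, ∀ v ∈ Ω, ∃ w ∈ inputs R, ‖v - w‖ < ε

/-- The horizon condition `R / h(R) → 0`, where `h(R)` is (eventually) positive. -/
def HorizonScaling (h : ℕ → ℕ) : Prop :=
  (∀ᶠ R in atTop, 0 < h R) ∧ Tendsto (fun R : ℕ => (R : ℝ) / (h R : ℝ)) atTop (𝓝 0)

/-- The partition condition `R / (Lf η(R)) (e^{Lf h(R) / R} - 1) → 0`, where `η > 0`. -/
def PartitionScaling (Lf : ℝ) (h : ℕ → ℕ) (η : ℕ → ℝ) : Prop :=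
  (∀ R, 0 < η R) ∧
  Tendsto (fun R : ℕ => (R : ℝ) / η R * expQuot Lf ((h R : ℝ) / R)) atTop (𝓝 0)

end

end GLC

/-! An output other than NULL lies in `Ugoal`, so no output costs less than `c*`. It remains to
bound the output cost by `J(u) + o(1)` for each fixed `u ∈ Ugoal`; no optimal signal is needed.

Let `x` be the trajectory of `u`. On cells of length `c / R` the signal is replaced by inputs `a i ∈
Ω_R` that converge to it almost everywhere (`exists_inputs_tendsto`), so the errors in input and
dynamics vanish in `L¹` (`tendsto_integral_norm_sub`). The resulting branch of the tree may have
been pruned. However, let `C` collect all nodes ever queued besides the root: each child of an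
expanded node is in `C`, infeasible, too deep, or preceded by a member of `C`
(`Reachable.exists_isExploredSet`). So the inputs `a i` are followed from the root, and a child
pruned by `z` is replaced by `z`, which ends in the same cell, lasts no longer and costs no more. As
`f` and `g` do not depend on time, the remaining inputs can be applied to `z`.

Each replacement adds at most `√n / η` to the distance from `x`, up to the Grönwall factor. There
are `O(R)` of them and `R / η → 0`, so these nodes stay in a tube inside `Xfree`, and after the last
step they would be in the goal. Since goal nodes are never expanded, the chain stops at a node still
in the queue (`Reachable.exists_mem_queue`). By monotonicity of the cost in time, this node costs at
most `J(u) + o(1)`, and an output of least cost in the queue costs no more.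

Termination holds because the depth is bounded: a weighted count of the queue decreases in each pass
(`Step.queuePotential_lt`). -/

namespace GLC

open MeasureTheory Set Filter Topology

noncomputable section

/-! ### Trajectories: Grönwall estimates, uniqueness, constant inputs. -/

section

/-- Grönwall's inequality in integral form. -/
lemma gronwall_integral {φ : ℝ → ℝ} {a b A L : ℝ} (hL : 0 ≤ L) (hφ : ContinuousOn φ (Icc a b))
    (h : ∀ t ∈ Icc a b, φ t ≤ A + L * ∫ s in a..t, φ s) :
    ∀ t ∈ Icc a b, φ t ≤ A * Real.exp (L * (t - a)) := by
  intro t ht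
  have hab : a ≤ b := ht.1.trans ht.2
  -- The constant extension is continuous on `ℝ`, so its integral is differentiable everywhere and
  -- the differential form of Grönwall's inequality applies to `Φ`.
  set ψ : ℝ → ℝ := IccExtend hab ((Icc a b).domRestrict φ) with hψ
  have hψc : Continuous ψ := hφ.domRestrict.Icc_extend'
  have hψe : ∀ s ∈ Icc a b, ψ s = φ s := fun s hs => by
    rw [hψ, IccExtend_of_mem hab _ hs, Set.domRestrict_apply]
  have hint : ∀ s ∈ Icc a b, ∫ r in a..s, φ r = ∫ r in a..s, ψ r := fun s hs => by
    refine intervalIntegral.integral_congr fun r hr => ?_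
    rw [uIcc_of_le hs.1] at hr
    exact (hψe r ⟨hr.1, hr.2.trans hs.2⟩).symm
  set Φ : ℝ → ℝ := fun s => A + L * ∫ r in a..s, ψ r with hΦ
  have hder : ∀ s, HasDerivAt Φ (L * ψ s) s := fun s =>
    ((hψc.integral_hasStrictDerivAt a s).hasDerivAt.const_mul L).const_add A
  have hle : ∀ s ∈ Icc a b, ψ s ≤ Φ s := fun s hs => by
    have := h s hs
    rwa [hint s hs, ← hψe s hs] at this
  have hG := le_gronwallBound_of_liminf_deriv_right_le (f := Φ) (f' := fun s => L * ψ s)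
    (δ := A) (K := L) (ε := 0) (a := a) (b := b)
    (fun s _ => (hder s).continuousAt.continuousWithinAt)
    (fun s _ r hr => (hder s).hasDerivWithinAt.liminf_right_slope_le hr)
    (by simp [hΦ])
    (fun s hs => by
      have := mul_le_mul_of_nonneg_left (hle s ⟨hs.1, hs.2.le⟩) hL
      simpa using this) t ht
  rw [gronwallBound_ε0] at hG
  exact (hψe t ht ▸ hle t ht).trans hG

variable {n m : ℕ} {P : Problem n m} {Lf Lg M : ℝ}

/-- `x` is a trajectory of `u` from `xic` in `Xfree`. The duration of `u` may vanish, and the value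
of `u` at its final time is irrelevant. -/
structure Problem.IsPath (P : Problem n m) (u : Signal m) (x : ℝ → E n) : Prop where
  dur_nonneg : 0 ≤ u.dur
  integrableOn_val : IntegrableOn u.val (Icc 0 u.dur)
  val_mem : ∀ t ∈ Ico 0 u.dur, u.val t ∈ P.Ω
  isTrajectory : P.IsTrajectory P.xic u x
  mem_Xfree : ∀ t ∈ Icc 0 u.dur, x t ∈ P.Xfree

/-- A trajectory that stays in `Xfree` coincides with all other trajectories. -/
lemma Problem.IsPath.eq_of_isTrajectory (hA1 : IsOpen P.Xfree) (hLf : 0 ≤ Lf)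
    (hA2 : P.DynamicsBounds Lf M) {u : Signal m} {x y : ℝ → E n} (hx : P.IsPath u x)
    (hy : P.IsTrajectory P.xic u y) : ∀ t ∈ Icc 0 u.dur, y t = x t := by
  obtain ⟨hxc, hxi, hxe⟩ := hx.isTrajectory
  obtain ⟨hyc, hyi, hye⟩ := hy
  set T := u.dur
  have hclosed : IsClosed ({t | y t = x t} ∩ Icc 0 T) := by
    have : {t | y t = x t} ∩ Icc 0 T = Icc 0 T ∩ (fun t => y t - x t) ⁻¹' {0} := by
      ext t; simp [sub_eq_zero, and_comm]
    rw [this]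
    exact (hyc.sub hxc).preimage_isClosed_of_isClosed isClosed_Icc isClosed_singleton
  have h0 : (0 : ℝ) ∈ Icc 0 T := ⟨le_rfl, hx.dur_nonneg⟩
  -- Continuation argument: `y` is not known to stay in `Xfree`, where alone `f` is Lipschitz.
  -- Openness keeps it there for a short time after each point of agreement, and Grönwall with
  -- initial error `0` extends the agreement.
  refine fun t ht => hclosed.Icc_subset_of_forall_exists_gt ?_ ?_ ht
  · simp [hxe 0 h0, hye 0 h0]
  rintro a ⟨hae, ha⟩ b hb
  have haT : a ∈ Icc 0 T := ⟨ha.1, ha.2.le⟩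
  have hev : ∀ᶠ s in 𝓝[Icc 0 T] a, y s ∈ P.Xfree :=
    (hyc a haT).eventually_mem (hA1.mem_nhds (by rw [hae]; exact hx.mem_Xfree a haT))
  obtain ⟨ε, hε, hball⟩ := Metric.mem_nhdsWithin_iff.1 hev
  set c := min (min b T) (a + ε / 2) with hc
  have hac : a < c := lt_min (lt_min hb ha.2) (by linarith)
  have hcT : c ≤ T := (min_le_left _ _).trans (min_le_right _ _)
  have hsub : Icc a c ⊆ Icc 0 T := Icc_subset_Icc ha.1 hcT
  have hyX : ∀ s ∈ Icc a c, y s ∈ P.Xfree := fun s hs => hball ⟨by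
    have h2 : s ≤ a + ε / 2 := hs.2.trans (min_le_right _ _)
    rw [Metric.mem_ball, Real.dist_eq, abs_of_nonneg (by linarith [hs.1])]; linarith, hsub hs⟩
  have hi {z : ℝ → E n} (hz : IntervalIntegrable (fun s => P.f (z s) (u.val s)) volume 0 T)
      {p q : ℝ} (hp : p ∈ Icc 0 T) (hq : q ∈ Icc 0 T) :
      IntervalIntegrable (fun s => P.f (z s) (u.val s)) volume p q :=
    hz.mono_set (by rw [uIcc_of_le hx.dur_nonneg]; exact uIcc_subset_Icc hp hq)
  have key : ∀ s ∈ Icc a c, ‖y s - x s‖ ≤ 0 + Lf * ∫ r in a..s, ‖y r - x r‖ := by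
    intro s hs
    have hs' := hsub hs
    have e1 : y s - x s = ∫ r in a..s, (P.f (y r) (u.val r) - P.f (x r) (u.val r)) := by
      rw [intervalIntegral.integral_sub (hi hyi haT hs') (hi hxi haT hs'),
        ← intervalIntegral.integral_interval_sub_left (hi hyi h0 hs') (hi hyi h0 haT),
        ← intervalIntegral.integral_interval_sub_left (hi hxi h0 hs') (hi hxi h0 haT)]
      have h1 := hye s hs'
      have h2 := hxe s hs'
      have h3 := hye a haT
      have h4 := hxe a haT
      have h5 : y a = x a := hae
      rw [h3, h4] at h5
      rw [h1, h2, add_left_cancel h5]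
      abel
    rw [e1, zero_add, ← intervalIntegral.integral_const_mul]
    refine intervalIntegral.norm_integral_le_of_norm_le hs.1 ?_ ?_
    -- The final time is a null set; the input there may lie outside `Ω`.
    · have : ∀ᵐ r : ℝ, r ≠ T := by simp [ae_iff]
      filter_upwards [this] with r hrT hr
      have hr' : r ∈ Icc a c := ⟨hr.1.le, hr.2.trans hs.2⟩
      exact hA2.1 _ (hyX r hr') _ (hx.mem_Xfree r (hsub hr')) _
        (hx.val_mem r ⟨(hsub hr').1, lt_of_le_of_ne (hsub hr').2 hrT⟩)
    · refine ContinuousOn.intervalIntegrable ?_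
      rw [uIcc_of_le hs.1]
      exact (continuousOn_const.mul (hyc.sub hxc).norm).mono
        fun r hr => hsub ⟨hr.1, hr.2.trans hs.2⟩
  refine ⟨c, ?_, hac, (min_le_left _ _).trans (min_le_left _ _)⟩
  have := gronwall_integral hLf ((hyc.sub hxc).norm.mono hsub) key c ⟨hac.le, le_rfl⟩
  rw [zero_mul] at this
  exact sub_eq_zero.1 (norm_le_zero_iff.1 this)

/-- Uniqueness makes the arbitrary choice in `sysMap` harmless: end states and costs can be computed
from any path. -/
lemma Problem.IsPath.sysMap_eq (hA1 : IsOpen P.Xfree) (hLf : 0 ≤ Lf)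
    (hA2 : P.DynamicsBounds Lf M) {u : Signal m} {x : ℝ → E n} (hx : P.IsPath u x) :
    ∀ t ∈ Icc 0 u.dur, P.sysMap P.xic u t = x t := by
  have hex : ∃ x, P.IsTrajectory P.xic u x := ⟨x, hx.isTrajectory⟩
  have : P.sysMap P.xic u = hex.choose := by rw [Problem.sysMap, dif_pos hex]
  rw [this]
  exact hx.eq_of_isTrajectory hA1 hLf hA2 hex.choose_spec

lemma isPath_sysMap_of_mem_Ufeas {u : Signal m} (hu : u ∈ P.Ufeas) :
    P.IsPath u (P.sysMap P.xic u) := by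
  obtain ⟨⟨h1, h2, h3⟩, hex, h5⟩ := hu
  refine ⟨h1.le, h2, fun t ht => h3 t ⟨ht.1, ht.2.le⟩, ?_, h5⟩
  rw [Problem.sysMap, dif_pos hex]
  exact hex.choose_spec

lemma Problem.IsPath.mem_Ufeas (hA1 : IsOpen P.Xfree) (hLf : 0 ≤ Lf)
    (hA2 : P.DynamicsBounds Lf M) {u : Signal m} {x : ℝ → E n} (hx : P.IsPath u x)
    (hpos : 0 < u.dur) (hend : u.val u.dur ∈ P.Ω) : u ∈ P.Ufeas := by
  refine ⟨⟨hpos, hx.integrableOn_val, fun t ht => ?_⟩, ⟨x, hx.isTrajectory⟩, fun t ht => ?_⟩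
  · rcases eq_or_lt_of_le ht.2 with h | h
    · rwa [h]
    · exact hx.val_mem t ⟨ht.1, h⟩
  · rw [hx.sysMap_eq hA1 hLf hA2 t ht]
    exact hx.mem_Xfree t ht

lemma Problem.IsPath.J_eq (hA1 : IsOpen P.Xfree) (hLf : 0 ≤ Lf)
    (hA2 : P.DynamicsBounds Lf M) {u : Signal m} {x : ℝ → E n} (hx : P.IsPath u x) :
    P.J P.xic u = ∫ t in (0 : ℝ)..u.dur, P.g (x t) (u.val t) := by
  refine intervalIntegral.integral_congr fun t ht => ?_
  rw [uIcc_of_le hx.dur_nonneg] at ht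
  simp only [hx.sysMap_eq hA1 hLf hA2 t ht]

lemma Problem.IsPath.trunc {u : Signal m} {x : ℝ → E n} (hx : P.IsPath u x) {s : ℝ}
    (hs : s ∈ Icc 0 u.dur) : P.IsPath (u.trunc s) x := by
  obtain ⟨hxc, hxi, hxe⟩ := hx.isTrajectory
  have hsub : Icc 0 s ⊆ Icc 0 u.dur := Icc_subset_Icc le_rfl hs.2
  refine ⟨hs.1, hx.integrableOn_val.mono_set hsub,
    fun t ht => hx.val_mem t ⟨ht.1, ht.2.trans_le hs.2⟩, ⟨hxc.mono hsub, hxi.mono_set ?_,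
    fun t ht => hxe t (hsub ht)⟩, fun t ht => hx.mem_Xfree t (hsub ht)⟩
  simpa only [uIcc_of_le hx.dur_nonneg, Signal.trunc, uIcc_of_le hs.1] using hsub

/-- Solution of `y' = f(y, a)` for a constant input `a` on an interval of length `Δ`. -/
lemma exists_constant_input_solution (hLf : 0 ≤ Lf) (hM : 0 ≤ M)
    (hA2 : P.DynamicsBounds Lf M) {a : E m} (ha : a ∈ P.Ω) {y₀ : E n} {ρ Δ : ℝ} (hρ : 0 ≤ ρ)
    (hΔ : 0 ≤ Δ) (hball : Metric.closedBall y₀ ρ ⊆ P.Xfree) (hMΔ : M * Δ ≤ ρ) :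
    ∃ Y : ℝ → E n, Continuous Y ∧ (∀ t, Y t ∈ P.Xfree) ∧
      (∀ t ∈ Icc 0 Δ, Y t = y₀ + ∫ s in (0 : ℝ)..t, P.f (Y s) a) := by
  lift M to NNReal using hM
  lift Lf to NNReal using hLf
  lift ρ to NNReal using hρ
  have hP : IsPicardLindelof (fun _ y => P.f y a) (⟨0, left_mem_Icc.2 hΔ⟩ : Icc 0 Δ) y₀
      ρ 0 M Lf := by
    refine IsPicardLindelof.of_time_independent (fun x hx => hA2.2 x (hball hx) a ha) ?_ ?_
    · refine LipschitzOnWith.of_dist_le_mul fun x hx y hy => ?_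
      rw [dist_eq_norm, dist_eq_norm]
      exact hA2.1 x (hball hx) y (hball hy) a ha
    · simpa [hΔ] using hMΔ
  -- The fixed point of the Picard operator gives the integral equation directly, and its extension
  -- `compProj` to `ℝ` keeps all values in the ball.
  obtain ⟨α, hα⟩ := ODE.FunSpace.exists_isFixedPt_next hP
    (x := y₀) (Metric.mem_closedBall_self le_rfl)
  replace hα := (ODE.FunSpace.isFixedPt_next_iff hP _).1 hα
  refine ⟨α.compProj, α.continuous_compProj,
    fun t => hball (α.compProj_mem_closedBall hP.mul_max_le), fun t ht => ?_⟩
  rw [ODE.FunSpace.compProj_of_mem ht, hα, ODE.picard_apply]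

lemma continuous_dynamics (hLf : 0 ≤ Lf) (hA2 : P.DynamicsBounds Lf M) {a : E m} (ha : a ∈ P.Ω)
    {Y : ℝ → E n} (hY : Continuous Y) (hYX : ∀ t, Y t ∈ P.Xfree) :
    Continuous fun t => P.f (Y t) a := by
  have : LipschitzOnWith ⟨Lf, hLf⟩ (fun x => P.f x a) P.Xfree :=
    LipschitzOnWith.of_dist_le_mul fun x hx y hy => by
      rw [dist_eq_norm, dist_eq_norm]; exact hA2.1 x hx y hy a ha
  exact this.continuousOn.comp_continuous hY hYX

/-- Distance of a solution for a constant input to a solution of `x' = F` in `Xfree`. -/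
lemma norm_sub_le_of_constant_input (hLf : 0 ≤ Lf)
    (hA2 : P.DynamicsBounds Lf M) {a : E m} (ha : a ∈ P.Ω) {y₀ : E n} {Δ t₀ D₀ : ℝ}
    {Y x : ℝ → E n} {F : ℝ → E n} (hYc : Continuous Y) (hYX : ∀ t, Y t ∈ P.Xfree)
    (hY : ∀ t ∈ Icc 0 Δ, Y t = y₀ + ∫ s in (0 : ℝ)..t, P.f (Y s) a)
    (hxc : Continuous x) (hxX : ∀ t, x t ∈ P.Xfree)
    (hF : IntervalIntegrable F volume t₀ (t₀ + Δ))
    (hx : ∀ t ∈ Icc 0 Δ, x (t₀ + t) = x t₀ + ∫ s in t₀..(t₀ + t), F s)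
    (hD : ‖y₀ - x t₀‖ ≤ D₀) :
    ∀ t ∈ Icc 0 Δ, ‖Y t - x (t₀ + t)‖ ≤
      (D₀ + ∫ s in t₀..(t₀ + Δ), ‖F s - P.f (x s) a‖) * Real.exp (Lf * Δ) := by
  intro t ht
  have hΔ : 0 ≤ Δ := ht.1.trans ht.2
  have hfx : Continuous fun s => P.f (x s) a := continuous_dynamics hLf hA2 ha hxc hxX
  have hfY : Continuous fun s => P.f (Y s) a := continuous_dynamics hLf hA2 ha hYc hYX
  have hxs : Continuous fun s => x (t₀ + s) := by fun_prop
  have hG : IntervalIntegrable (fun s => ‖F s - P.f (x s) a‖) volume t₀ (t₀ + Δ) :=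
    (hF.sub (hfx.intervalIntegrable _ _)).norm
  have key : ∀ s ∈ Icc 0 Δ, ‖Y s - x (t₀ + s)‖ ≤
      (D₀ + ∫ s in t₀..(t₀ + Δ), ‖F s - P.f (x s) a‖) +
        Lf * ∫ r in (0 : ℝ)..s, ‖Y r - x (t₀ + r)‖ := by
    intro s hs
    have hsub : uIcc t₀ (t₀ + s) ⊆ uIcc t₀ (t₀ + Δ) := by
      rw [uIcc_of_le (by linarith [hs.1]), uIcc_of_le (by linarith)]
      exact Icc_subset_Icc le_rfl (by linarith [hs.2])
    have hFs := hF.mono_set hsub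
    -- `F` is split into `F - f(x, a)` and `f(x, a)`. The first part enters the constant of
    -- Grönwall's inequality, the second is compared with `Y` by the Lipschitz bound.
    have e1 : ∫ r in t₀..(t₀ + s), F r
        = (∫ r in t₀..(t₀ + s), (F r - P.f (x r) a)) +
          ∫ r in (0 : ℝ)..s, P.f (x (t₀ + r)) a := by
      have := intervalIntegral.integral_comp_add_left (a := 0) (b := s)
        (fun r => P.f (x r) a) t₀
      rw [this, add_zero, intervalIntegral.integral_sub hFs (hfx.intervalIntegrable _ _)]
      abel
    have hfxs : Continuous fun r => P.f (x (t₀ + r)) a :=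
      continuous_dynamics hLf hA2 ha hxs fun r => hxX _
    have e2 : Y s - x (t₀ + s) = (y₀ - x t₀) - (∫ r in t₀..(t₀ + s), (F r - P.f (x r) a)) +
        ∫ r in (0 : ℝ)..s, (P.f (Y r) a - P.f (x (t₀ + r)) a) := by
      rw [intervalIntegral.integral_sub (hfY.intervalIntegrable _ _)
        (hfxs.intervalIntegrable _ _), hY s hs, hx s hs, e1]
      abel
    have b1 : ‖∫ r in t₀..(t₀ + s), (F r - P.f (x r) a)‖ ≤
        ∫ s in t₀..(t₀ + Δ), ‖F s - P.f (x s) a‖ := by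
      refine (intervalIntegral.norm_integral_le_integral_norm (by linarith [hs.1])).trans ?_
      refine intervalIntegral.integral_mono_interval le_rfl (by linarith [hs.1])
        (by linarith [hs.2]) (Eventually.of_forall fun r => norm_nonneg _) hG
    have b2 : ‖∫ r in (0 : ℝ)..s, (P.f (Y r) a - P.f (x (t₀ + r)) a)‖ ≤
        Lf * ∫ r in (0 : ℝ)..s, ‖Y r - x (t₀ + r)‖ := by
      rw [← intervalIntegral.integral_const_mul]
      refine intervalIntegral.norm_integral_le_of_norm_le hs.1
        (Eventually.of_forall fun r _ => hA2.1 _ (hYX r) _ (hxX _) _ ha) ?_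
      exact (continuous_const.mul (hYc.sub hxs).norm).intervalIntegrable _ _
    rw [e2]
    calc _ ≤ ‖y₀ - x t₀‖ + ‖∫ r in t₀..(t₀ + s), (F r - P.f (x r) a)‖ + _ :=
          (norm_add_le _ _).trans (add_le_add (norm_sub_le _ _) le_rfl)
      _ ≤ _ := by linarith
  have h1 := gronwall_integral hLf (hYc.sub hxs).norm.continuousOn key t ht
  refine h1.trans (mul_le_mul_of_nonneg_left (Real.exp_le_exp.2 ?_) ?_)
  · exact mul_le_mul_of_nonneg_left (by linarith [ht.2]) hLf
  · have : 0 ≤ ∫ s in t₀..(t₀ + Δ), ‖F s - P.f (x s) a‖ :=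
      intervalIntegral.integral_nonneg (by linarith) fun s _ => norm_nonneg _
    linarith [(norm_nonneg _).trans hD]

end

/-! ### Integrability of the cost and concatenation of paths. -/

section

variable {n m : ℕ} {P : Problem n m} {Lf Lg M : ℝ}

lemma Problem.CostLipschitz.abs_sub_le (hLg : 0 ≤ Lg) (hA3 : P.CostLipschitz Lg) {x₁ x₂ : E n}
    {u₁ u₂ : E m} (hx₁ : x₁ ∈ P.Xfree) (hx₂ : x₂ ∈ P.Xfree) (hu₁ : u₁ ∈ P.Ω) (hu₂ : u₂ ∈ P.Ω) :
    |P.g x₁ u₁ - P.g x₂ u₂| ≤ Lg * (‖x₁ - x₂‖ + ‖u₁ - u₂‖) := by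
  refine (hA3 x₁ hx₁ x₂ hx₂ u₁ hu₁ u₂ hu₂).trans (mul_le_mul_of_nonneg_left ?_ hLg)
  refine Real.sqrt_le_iff.2 ⟨by positivity, ?_⟩
  nlinarith [mul_nonneg (norm_nonneg (x₁ - x₂)) (norm_nonneg (u₁ - u₂))]

lemma Problem.CostLipschitz.continuous_cost (hLg : 0 ≤ Lg) (hA3 : P.CostLipschitz Lg) {a : E m}
    (ha : a ∈ P.Ω) {Y : ℝ → E n} (hY : Continuous Y) (hYX : ∀ t, Y t ∈ P.Xfree) :
    Continuous fun t => P.g (Y t) a := by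
  have : LipschitzOnWith ⟨Lg, hLg⟩ (fun x => P.g x a) P.Xfree :=
    LipschitzOnWith.of_dist_le_mul fun x hx y hy => by
      rw [Real.dist_eq, dist_eq_norm]
      have := hA3.abs_sub_le hLg hx hy ha ha
      rwa [sub_self, norm_zero, add_zero] at this
  exact this.continuousOn.comp_continuous hY hYX

/-- The running cost along a path is integrable. -/
lemma Problem.IsPath.intervalIntegrable_cost (hLg : 0 ≤ Lg) (hA3 : P.CostLipschitz Lg)
    {u : Signal m} {x : ℝ → E n} (hx : P.IsPath u x) :
    IntervalIntegrable (fun t => P.g (x t) (u.val t)) volume 0 u.dur := by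
  -- The factor `2` bounds the sum of two norms by the sup norm of the product.
  have hlip : LipschitzOnWith ⟨Lg * 2, by positivity⟩ (fun p : E n × E m => P.g p.1 p.2)
      (P.Xfree ×ˢ P.Ω) := by
    refine LipschitzOnWith.of_dist_le_mul fun p hp q hq => ?_
    rw [Real.dist_eq, dist_eq_norm]
    refine (hA3.abs_sub_le hLg hp.1 hq.1 hp.2 hq.2).trans ?_
    have h1 := norm_fst_le (p - q)
    have h2 := norm_snd_le (p - q)
    change Lg * (‖(p - q).1‖ + ‖(p - q).2‖) ≤ Lg * 2 * ‖p - q‖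
    rw [mul_assoc]
    exact mul_le_mul_of_nonneg_left (by linarith) hLg
  -- Nothing is known of `g` outside `Xfree × Ω`. A global Lipschitz extension supplies
  -- measurability, and its linear growth gives an integrable bound.
  obtain ⟨G, hG, hGeq⟩ := hlip.extend_real
  have hxc := hx.isTrajectory.1
  have hui := hx.integrableOn_val
  have hpair : IntegrableOn (fun t => (x t, u.val t)) (Icc 0 u.dur) :=
    (hxc.integrableOn_Icc).prodMk hui
  have hGi : IntegrableOn (fun t => G (x t, u.val t)) (Icc 0 u.dur) := by
    refine Integrable.mono' (g := fun t => ‖G 0‖ + Lg * 2 * ‖(x t, u.val t)‖)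
      ((integrableOn_const (by simp)).add (hpair.norm.const_mul _))
      (hG.continuous.comp_aestronglyMeasurable hpair.aestronglyMeasurable)
      (Eventually.of_forall fun t => ?_)
    have := hG.dist_le_mul (x t, u.val t) 0
    rw [dist_zero_right, dist_eq_norm] at this
    have h3 := norm_le_norm_add_norm_sub (G 0) (G (x t, u.val t))
    rw [norm_sub_rev] at h3
    exact h3.trans (add_le_add le_rfl this)
  have h1 : IntervalIntegrable (fun t => G (x t, u.val t)) volume 0 u.dur :=
    (intervalIntegrable_iff_integrableOn_Icc_of_le hx.dur_nonneg).2 hGi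
  refine h1.congr_uIoo fun t ht => ?_
  rw [uIoo_of_le hx.dur_nonneg] at ht
  exact (hGeq (x := (x t, u.val t))
    ⟨hx.mem_Xfree t ⟨ht.1.le, ht.2.le⟩, hx.val_mem t ⟨ht.1.le, ht.2⟩⟩).symm

lemma integral_piecewise_shift {V : Type*} [NormedAddCommGroup V] [NormedSpace ℝ V] {F A B : ℝ → V}
    {a b : ℝ} (hA : IntervalIntegrable A volume 0 a)
    (hB : IntervalIntegrable B volume 0 b) (ha : 0 ≤ a) (hb : 0 ≤ b)
    (hFA : ∀ t ∈ Ioo 0 a, F t = A t) (hFB : ∀ t ∈ Ioo a (a + b), F t = B (t - a)) :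
    IntervalIntegrable F volume 0 (a + b) ∧
      ∫ t in (0 : ℝ)..(a + b), F t = (∫ t in (0 : ℝ)..a, A t) + ∫ t in (0 : ℝ)..b, B t := by
  have e1 : EqOn A F (uIoo 0 a) := fun t ht => by
    rw [uIoo_of_le ha] at ht; exact (hFA t ht).symm
  have e2 : EqOn (fun t => B (t - a)) F (uIoo a (a + b)) := fun t ht => by
    rw [uIoo_of_le (by linarith)] at ht; exact (hFB t ht).symm
  have hB' : IntervalIntegrable (fun t => B (t - a)) volume a (a + b) := by
    have := hB.comp_sub_right a
    rwa [zero_add, add_comm b a] at this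
  have i1 := hA.congr_uIoo e1
  have i2 := hB'.congr_uIoo e2
  refine ⟨i1.trans i2, ?_⟩
  rw [← intervalIntegral.integral_add_adjacent_intervals i1 i2,
    ← intervalIntegral.integral_congr_uIoo e1, ← intervalIntegral.integral_congr_uIoo e2,
    intervalIntegral.integral_comp_sub_right, sub_self, add_sub_cancel_left]

/-- Extension of a path by the solution `Y` for a constant input `a`. -/
lemma Problem.IsPath.append_constant (hLf : 0 ≤ Lf) (hLg : 0 ≤ Lg)
    (hA2 : P.DynamicsBounds Lf M) (hA3 : P.CostLipschitz Lg) {u w : Signal m} {x Y : ℝ → E n}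
    {a : E m} {Δ : ℝ} (hx : P.IsPath u x) (ha : a ∈ P.Ω) (hΔ : 0 ≤ Δ) (hdur : w.dur = u.dur + Δ)
    (hval₁ : ∀ t ∈ Ico 0 u.dur, w.val t = u.val t)
    (hval₂ : ∀ t ∈ Icc u.dur (u.dur + Δ), w.val t = a)
    (hYc : Continuous Y) (hYX : ∀ t, Y t ∈ P.Xfree)
    (hY : ∀ t ∈ Icc 0 Δ, Y t = x u.dur + ∫ s in (0 : ℝ)..t, P.f (Y s) a) :
    ∃ z, P.IsPath w z ∧ z w.dur = Y Δ ∧ ∫ t in (0 : ℝ)..w.dur, P.g (z t) (w.val t) =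
      (∫ t in (0 : ℝ)..u.dur, P.g (x t) (u.val t)) + ∫ t in (0 : ℝ)..Δ, P.g (Y t) a := by
  obtain ⟨hxc, hxi, hxe⟩ := hx.isTrajectory
  have hd := hx.dur_nonneg
  set T := u.dur with hT
  have hY0 : Y 0 = x T := by simpa using hY 0 ⟨le_rfl, hΔ⟩
  set z : ℝ → E n := fun t => if t ≤ T then x t else Y (t - T) with hz
  have hz1 : ∀ t, t ≤ T → z t = x t := fun t ht => by simp [hz, ht]
  have hz2 : ∀ t, T ≤ t → z t = Y (t - T) := fun t ht => by
    rcases eq_or_lt_of_le ht with h | h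
    · rw [← h, hz1 T le_rfl, sub_self, hY0]
    · simp [hz, not_le.2 h]
  have hfY : Continuous fun s => P.f (Y s) a := continuous_dynamics hLf hA2 ha hYc hYX
  have hgY : Continuous fun s => P.g (Y s) a := hA3.continuous_cost hLg ha hYc hYX
  have hf1 : ∀ t ∈ Ioo 0 T, P.f (z t) (w.val t) = P.f (x t) (u.val t) := fun t ht => by
    rw [hz1 t ht.2.le, hval₁ t ⟨ht.1.le, ht.2⟩]
  have hf2 : ∀ t ∈ Ioo T (T + Δ), P.f (z t) (w.val t) = P.f (Y (t - T)) a := fun t ht => by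
    rw [hz2 t ht.1.le, hval₂ t ⟨ht.1.le, ht.2.le⟩]
  have hf := integral_piecewise_shift hxi (hfY.intervalIntegrable 0 Δ) hd hΔ hf1 hf2
  have hg := integral_piecewise_shift (F := fun t => P.g (z t) (w.val t))
    (hx.intervalIntegrable_cost hLg hA3) (hgY.intervalIntegrable 0 Δ) hd hΔ
    (fun t ht => by rw [hz1 t ht.2.le, hval₁ t ⟨ht.1.le, ht.2⟩])
    (fun t ht => by rw [hz2 t ht.1.le, hval₂ t ⟨ht.1.le, ht.2.le⟩])
  have hunion : Icc 0 (T + Δ) = Icc 0 T ∪ Icc T (T + Δ) :=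
    (Icc_union_Icc_eq_Icc hd (by linarith)).symm
  have hzc : ContinuousOn z (Icc 0 (T + Δ)) := by
    rw [hunion]
    refine ContinuousOn.union_of_isClosed ?_ ?_ isClosed_Icc isClosed_Icc
    · exact hxc.congr fun t ht => hz1 t ht.2
    · exact (hYc.comp (continuous_id.sub continuous_const)).continuousOn.congr
        fun t ht => hz2 t ht.1
  refine ⟨z, ⟨by rw [hdur]; linarith, ?_, ?_, ⟨by rwa [hdur], by rw [hdur]; exact hf.1, ?_⟩, ?_⟩,
    ?_, by rw [hdur]; exact hg.2⟩
  · rw [hdur, hunion]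
    refine IntegrableOn.union ?_ ?_
    · rw [integrableOn_Icc_iff_integrableOn_Ico]
      exact (hx.integrableOn_val.mono_set Ico_subset_Icc_self).congr_fun
        (fun t ht => (hval₁ t ht).symm) measurableSet_Ico
    · exact (integrableOn_const (C := a) (by simp)).congr_fun
        (fun t ht => (hval₂ t ht).symm) measurableSet_Icc
  · intro t ht
    rw [hdur] at ht
    rcases lt_or_ge t T with h | h
    · rw [hval₁ t ⟨ht.1, h⟩]; exact hx.val_mem t ⟨ht.1, h⟩
    · rwa [hval₂ t ⟨h, ht.2.le⟩]
  · intro t ht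
    rw [hdur] at ht
    rcases le_total t T with h | h
    · rw [hz1 t h, hxe t ⟨ht.1, h⟩]
      congr 1
      refine intervalIntegral.integral_congr_uIoo fun s hs => ?_
      rw [uIoo_of_le ht.1] at hs
      exact (hf1 s ⟨hs.1, hs.2.trans_le h⟩).symm
    · have h0 : 0 ≤ t - T := sub_nonneg.2 h
      have := (integral_piecewise_shift (F := fun t => P.f (z t) (w.val t)) (b := t - T) hxi
        (hfY.intervalIntegrable 0 (t - T)) hd h0 hf1
        fun s hs => hf2 s ⟨hs.1, hs.2.trans_le (by linarith [ht.2])⟩).2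
      rw [add_sub_cancel] at this
      rw [this, hz2 t h, hY _ ⟨h0, by linarith [ht.2]⟩, hxe T ⟨hd, le_rfl⟩, add_assoc]
  · intro t ht
    rw [hdur] at ht
    rcases le_total t T with h | h
    · rw [hz1 t h]; exact hx.mem_Xfree t ⟨ht.1, h⟩
    · rw [hz2 t h]; exact hYX _
  · rw [hdur, hz2 _ (by linarith), add_sub_cancel_left]

/-! ### Nodes of the search tree as signals. -/

variable {D : Params m} {R : ℕ}

@[simp]
lemma toSignal_dur (w : Node m) : (D.toSignal R w).dur = D.c * w.length / R := rfl

lemma toSignal_append_dur (w : Node m) (a : E m) :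
    (D.toSignal R (w ++ [a])).dur = (D.toSignal R w).dur + D.c / R := by
  simp; ring

lemma toSignal_append_val_of_lt (hc : 0 < D.c) (hR : 0 < R) (w : Node m) (a : E m) {t : ℝ}
    (ht : t ∈ Ico 0 (D.toSignal R w).dur) :
    (D.toSignal R (w ++ [a])).val t = (D.toSignal R w).val t := by
  have hR' : (0 : ℝ) < R := by exact_mod_cast hR
  have h1 : t * R / D.c < w.length := by
    have := ht.2
    rw [toSignal_dur, lt_div_iff₀ hR'] at this
    rw [div_lt_iff₀ hc]; linarith
  have h2 : ⌊t * R / D.c⌋₊ < w.length :=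
    (Nat.floor_lt (by have := ht.1; positivity)).2 h1
  simp only [Params.toSignal, List.length_append, List.length_singleton, Nat.add_sub_cancel]
  rw [min_eq_left h2.le, min_eq_left (by omega), List.getD_append _ _ _ _ h2]

/-- The `min` in `toSignal` clamps the index to the last input, so no upper bound on `t` is needed
and the closed right endpoint is covered. -/
lemma toSignal_append_val_of_ge (hc : 0 < D.c) (hR : 0 < R) (w : Node m) (a : E m) {t : ℝ}
    (ht : (D.toSignal R w).dur ≤ t) : (D.toSignal R (w ++ [a])).val t = a := by
  have hR' : (0 : ℝ) < R := by exact_mod_cast hR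
  have h1 : (w.length : ℝ) ≤ t * R / D.c := by
    rw [toSignal_dur, div_le_iff₀ hR'] at ht
    rw [le_div_iff₀ hc]; linarith
  have h2 : w.length ≤ ⌊t * R / D.c⌋₊ := Nat.le_floor h1
  simp only [Params.toSignal, List.length_append, List.length_singleton, Nat.add_sub_cancel]
  rw [min_eq_right h2, List.getD_append_right _ _ _ _ le_rfl]
  simp

/-- Nodes whose trajectory exists and stays in `Xfree`; contrary to `Ufeas` this includes `Id`. -/
def FeasibleNode (P : Problem n m) (D : Params m) (R : ℕ) (v : Node m) : Prop :=
  v = [] ∨ D.toSignal R v ∈ P.Ufeas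

lemma FeasibleNode.isPath (hxic : P.xic ∈ P.Xfree) {v : Node m} (hv : FeasibleNode P D R v) :
    ∃ x, P.IsPath (D.toSignal R v) x := by
  rcases hv with rfl | hv
  -- The root has duration `0`; as `Ico 0 0` is empty, its default input `0` need not belong to `Ω`.
  · refine ⟨fun _ => P.xic, by simp, ?_, ?_, ⟨continuousOn_const, ?_, ?_⟩, fun _ _ => hxic⟩
    · simp
    · simp
    · simp
    · intro t ht
      simp only [toSignal_dur, List.length_nil, CharP.cast_eq_zero, mul_zero, zero_div,
        Icc_self, mem_singleton_iff] at ht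
      simp [ht]
  · exact ⟨_, isPath_sysMap_of_mem_Ufeas hv⟩

/-- The child of a node for the input `a`, in terms of a solution `Y` for the constant input `a`
that starts in the end state of the node. -/
lemma FeasibleNode.append (hxic : P.xic ∈ P.Xfree) (hA1 : IsOpen P.Xfree) (hLf : 0 ≤ Lf)
    (hLg : 0 ≤ Lg) (hA2 : P.DynamicsBounds Lf M) (hA3 : P.CostLipschitz Lg) (hc : 0 < D.c)
    (hR : 0 < R) {v : Node m} (hv : FeasibleNode P D R v) {a : E m} (ha : a ∈ P.Ω)
    {Y : ℝ → E n} (hYc : Continuous Y) (hYX : ∀ t, Y t ∈ P.Xfree)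
    (hY : ∀ t ∈ Icc 0 (D.c / R), Y t = endState P D R v + ∫ s in (0 : ℝ)..t, P.f (Y s) a) :
    D.toSignal R (v ++ [a]) ∈ P.Ufeas ∧ endState P D R (v ++ [a]) = Y (D.c / R) ∧
      nodeJ P D R (v ++ [a]) = nodeJ P D R v + ∫ t in (0 : ℝ)..(D.c / R), P.g (Y t) a := by
  obtain ⟨x, hx⟩ := hv.isPath hxic
  have hR' : (0 : ℝ) < R := by exact_mod_cast hR
  have hΔ : 0 < D.c / R := by positivity
  have hend : endState P D R v = x (D.toSignal R v).dur :=
    hx.sysMap_eq hA1 hLf hA2 _ ⟨hx.dur_nonneg, le_rfl⟩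
  rw [hend] at hY
  obtain ⟨z, hz, hz1, hz2⟩ := hx.append_constant hLf hLg hA2 hA3 ha hΔ.le
    (toSignal_append_dur v a) (fun t ht => toSignal_append_val_of_lt hc hR v a ht)
    (fun t ht => toSignal_append_val_of_ge hc hR v a ht.1) hYc hYX hY
  have hd : (D.toSignal R v).dur ≤ (D.toSignal R (v ++ [a])).dur := by
    rw [toSignal_append_dur]; linarith
  refine ⟨hz.mem_Ufeas hA1 hLf hA2 ?_ ?_, ?_, ?_⟩
  · rw [toSignal_append_dur]; linarith [hx.dur_nonneg]
  · rwa [toSignal_append_val_of_ge hc hR v a hd]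
  · rw [← hz1]; exact hz.sysMap_eq hA1 hLf hA2 _ ⟨hz.dur_nonneg, le_rfl⟩
  · rw [nodeJ, nodeJ, hz.J_eq hA1 hLf hA2, hx.J_eq hA1 hLf hA2, hz2]

@[simp]
lemma nodeJ_nil : nodeJ P D R [] = 0 := by
  simp [nodeJ, Problem.J]

lemma endState_nil (hxic : P.xic ∈ P.Xfree) (hA1 : IsOpen P.Xfree) (hLf : 0 ≤ Lf)
    (hA2 : P.DynamicsBounds Lf M) : endState P D R [] = P.xic := by
  obtain ⟨x, hx⟩ := FeasibleNode.isPath (P := P) (D := D) (R := R) hxic (Or.inl rfl)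
  have h0 : (0 : ℝ) ∈ Icc 0 (D.toSignal R ([] : Node m)).dur := by simp
  have := hx.isTrajectory.2.2 0 h0
  have h2 := hx.sysMap_eq hA1 hLf hA2 0 h0
  rw [this] at h2
  simpa [endState] using h2

/-- The end states of equivalent nodes are close. -/
lemma Equivalent.norm_sub_le {u w : Node m} (hη : 0 < D.η R) (h : Equivalent P D R u w) :
    ‖endState P D R u - endState P D R w‖ ≤ Real.sqrt n / D.η R := by
  rw [EuclideanSpace.norm_eq, ← Real.sqrt_sq hη.le, ← Real.sqrt_div (by positivity)]
  refine Real.sqrt_le_sqrt ?_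
  calc _ ≤ ∑ _i : Fin n, 1 / D.η R ^ 2 := by
        refine Finset.sum_le_sum fun i _ => ?_
        have := Int.abs_sub_lt_one_of_floor_eq_floor (h i)
        rw [← mul_sub, abs_mul, abs_of_pos hη] at this
        rw [PiLp.sub_apply, Real.norm_eq_abs, le_div_iff₀ (by positivity), mul_comm, ← mul_pow]
        exact pow_le_one₀ (by positivity) this.le
    _ = _ := by simp [div_eq_mul_inv]

end

/-! ### The search: invariant of the explored nodes and termination. -/

section

variable {n m : ℕ} {P : Problem n m} {D : Params m} {R : ℕ}

/-- `w` fails one of the tests of the inner loop, the GLC conditions being tested against `C`. -/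
def PrunedBy (P : Problem n m) (D : Params m) (R : ℕ) (C : Set (Node m)) (w : Node m) : Prop :=
  D.toSignal R w ∉ P.Ufeas ∨ D.h R ≤ w.length ∨ ∃ y ∈ C, Prec P D R y w

lemma PrunedBy.mono {C C' : Set (Node m)} (h : C ⊆ C') {w : Node m} (hw : PrunedBy P D R C w) :
    PrunedBy P D R C' w :=
  hw.imp_right (Or.imp_right fun ⟨y, hy, hyw⟩ => ⟨y, h hy, hyw⟩)

lemma exists_examine (w : Node m) (s : LoopState m) : ∃ s', Examine P D R w s s' := by
  obtain ⟨z, hz⟩ : ∃ z, IsFind P D R w s.2 z := by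
    by_cases h : ∃ y ∈ s.2, Equivalent P D R w y
    · obtain ⟨y, hy⟩ := h
      exact ⟨some y, hy⟩
    · push Not at h
      exact ⟨none, h⟩
  by_cases h1 : Discard P D R w z
  · exact ⟨_, z, hz, Or.inl ⟨h1, rfl⟩⟩
  by_cases h2 : (nodeJ P D R w : EReal) < nodeCost P D R z
  · exact ⟨_, z, hz, Or.inr (Or.inl ⟨h1, h2, rfl⟩)⟩
  · exact ⟨_, z, hz, Or.inr (Or.inr ⟨h1, h2, rfl⟩)⟩

lemma exists_forLoop (l : List (Node m)) (s : LoopState m) : ∃ s', ForLoop P D R l s s' := by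
  induction l generalizing s with
  | nil => exact ⟨s, rfl⟩
  | cons w l ih =>
    obtain ⟨s₁, h₁⟩ := exists_examine (P := P) (D := D) (R := R) w s
    obtain ⟨s', h'⟩ := ih s₁
    exact ⟨s', s₁, h₁, h'⟩

lemma Examine.subset {w : Node m} {s s' : LoopState m} (h : Examine P D R w s s') :
    s'.1 ⊆ s.1 ∧ ∀ v ∈ s.1, v ≠ w → v ∈ s'.1 := by
  obtain ⟨z, -, ⟨-, rfl⟩ | ⟨-, -, rfl⟩ | ⟨-, -, rfl⟩⟩ := h
  · exact ⟨Finset.erase_subset _ _, fun v hv hvw => Finset.mem_erase.2 ⟨hvw, hv⟩⟩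
  · exact ⟨subset_rfl, fun v hv _ => hv⟩
  · exact ⟨subset_rfl, fun v hv _ => hv⟩

lemma ForLoop.subset {l : List (Node m)} {s s' : LoopState m} (h : ForLoop P D R l s s') :
    s'.1 ⊆ s.1 ∧ ∀ v ∈ s.1, v ∉ l → v ∈ s'.1 := by
  induction l generalizing s with
  | nil => cases h; exact ⟨subset_rfl, fun v hv _ => hv⟩
  | cons w l ih =>
    obtain ⟨s₁, h₁, h₂⟩ := h
    obtain ⟨a, b⟩ := ih h₂
    refine ⟨a.trans h₁.subset.1, fun v hv hvl => ?_⟩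
    rw [List.mem_cons, not_or] at hvl
    exact b v (h₁.subset.2 v hv hvl.1) hvl.2

/-- As the list has no duplicates, a child that passes its test is never erased later and hence
belongs to the final `S`. Therefore it suffices that `C` contains the initial labels and the final
`S`: every label consulted on the way is then in `C`. -/
lemma ForLoop.spec {l : List (Node m)} {s s' : LoopState m} (h : ForLoop P D R l s s')
    (hl : l.Nodup) (hls : ∀ w ∈ l, w ∈ s.1) {C : Set (Node m)} (hC : ↑s.2 ⊆ C) (hC' : ↑s'.1 ⊆ C) :
    ↑s'.2 ⊆ C ∧ ∀ w ∈ l, (w ∈ s'.1 ∧ D.toSignal R w ∈ P.Ufeas ∧ w.length < D.h R) ∨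
      (w ∉ s'.1 ∧ PrunedBy P D R C w) := by
  induction l generalizing s with
  | nil => cases h; exact ⟨hC, by simp⟩
  | cons w l ih =>
    obtain ⟨s₁, h₁, h₂⟩ := h
    rw [List.nodup_cons] at hl
    have hls₁ : ∀ v ∈ l, v ∈ s₁.1 := fun v hv =>
      h₁.subset.2 v (hls v (List.mem_cons_of_mem _ hv)) fun e => hl.1 (e ▸ hv)
    have hw := hls w List.mem_cons_self
    have hkeep : w ∈ s₁.1 → w ∈ s'.1 := fun hw₁ => h₂.subset.2 w hw₁ hl.1
    obtain ⟨z, hz, ⟨hd, rfl⟩ | ⟨hd, -, rfl⟩ | ⟨hd, -, rfl⟩⟩ := h₁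
    · obtain ⟨a, b⟩ := ih h₂ hl.2 hls₁ hC
      refine ⟨a, fun v hv => ?_⟩
      rcases List.mem_cons.1 hv with rfl | hv
      · refine Or.inr ⟨fun hv' => Finset.notMem_erase _ _ (h₂.subset.1 hv'), ?_⟩
        rcases hd with hd | ⟨y, rfl, hy⟩ | hd
        · exact Or.inl hd
        · exact Or.inr (Or.inr ⟨y, hC hz.1, hy⟩)
        · exact Or.inr (Or.inl hd)
      · exact b v hv
    all_goals
      simp only [Discard, not_or, not_not, not_le] at hd
      have hwC : w ∈ C := hC' (hkeep hw)
      obtain ⟨a, b⟩ := ih h₂ hl.2 hls₁ (by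
        intro v hv
        first
          | exact hC hv
          | rcases Finset.mem_insert.1 hv with e | hv
            · exact e ▸ hwC
            · exact hC (Finset.mem_sdiff.1 hv).1)
      refine ⟨a, fun v hv => ?_⟩
      rcases List.mem_cons.1 hv with rfl | hv
      · exact Or.inl ⟨hkeep hw, hd.1, hd.2.2⟩
      · exact b v hv

lemma mem_expand {u w : Node m} : w ∈ expand D R u ↔ ∃ a ∈ D.inputs R, u ++ [a] = w := by
  simp [expand]

/-- What a pass of the outer loop does, in terms of the popped node `u` and the set `S` of its
remaining children. -/
lemma Step.spec {s s' : LoopState m} (h : Step P D R s s') :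
    ∃ u ∈ s.1, D.toSignal R u ∉ P.Ugoal ∧ ∃ S : Finset (Node m), S ⊆ expand D R u ∧
      (∀ w, w ∈ s'.1 ↔ (w ≠ u ∧ w ∈ s.1) ∨ w ∈ S) ∧
      (∀ w ∈ S, D.toSignal R w ∈ P.Ufeas ∧ w.length < D.h R) ∧
      ∀ C : Set (Node m), ↑s.2 ⊆ C → ↑S ⊆ C →
        ↑s'.2 ⊆ C ∧ ∀ w ∈ expand D R u, w ∈ S ∨ PrunedBy P D R C w := by
  obtain ⟨u, hu, hgoal, l, hl, S, hloop, hs'⟩ := h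
  have hmem : ∀ w, w ∈ l ↔ w ∈ expand D R u := fun w => by
    rw [← Finset.mem_val, ← hl, Multiset.mem_coe]
  have hnd : l.Nodup := by
    rw [← Multiset.coe_nodup, hl]; exact (expand D R u).nodup
  have hls : ∀ w ∈ l, w ∈ expand D R u := fun w => (hmem w).1
  refine ⟨u, hu.1, hgoal, S, hloop.subset.1, fun w => by simp [hs'], fun w hw => ?_,
    fun C hC hSC => ?_⟩
  · have := (hloop.spec hnd hls (subset_univ _) (subset_univ _)).2 w
      ((hmem w).2 (hloop.subset.1 hw))
    rcases this with h | h
    · exact h.2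
    · exact absurd hw h.1
  · obtain ⟨a, b⟩ := hloop.spec hnd hls hC hSC
    refine ⟨a, fun w hw => ?_⟩
    exact (b w ((hmem w).2 hw)).imp (fun h => h.1) fun h => h.2

/-- A set `C` of feasible nodes that, together with the root, contains the queue and the labels of
the state `s` and is closed under expansion up to pruning, apart from the queue. -/
structure IsExploredSet (P : Problem n m) (D : Params m) (R : ℕ) (s : LoopState m)
    (C : Set (Node m)) : Prop where
  queue_subset : ↑s.1 ⊆ insert [] C
  labels_subset : ↑s.2 ⊆ C
  feasible : ∀ v ∈ C, D.toSignal R v ∈ P.Ufeas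
  expanded : ∀ v ∈ insert [] C, v ∈ s.1 ∨ (D.toSignal R v ∉ P.Ugoal ∧
    ∀ a ∈ D.inputs R, v ++ [a] ∈ C ∨ PrunedBy P D R C (v ++ [a]))

/-- `C` grows by `S` in each pass and never shrinks. Nodes that leave the queue or the labels stay
in `C`, so earlier witnesses of pruning remain valid. -/
lemma Reachable.exists_isExploredSet {s : LoopState m} (h : Reachable P D R s) :
    ∃ C, IsExploredSet P D R s C := by
  induction h with
  | refl => exact ⟨∅, by simp [initState], by simp [initState], by simp,
      fun v hv => Or.inl (by simpa [initState] using hv)⟩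
  | @tail s s' _ hstep ih =>
    obtain ⟨C, hC⟩ := ih
    obtain ⟨u, hu, hgoal, S, -, hQ, hfeas, hspec⟩ := hstep.spec
    obtain ⟨hlab, hexp⟩ := hspec (C ∪ ↑S) (hC.labels_subset.trans subset_union_left)
      subset_union_right
    refine ⟨C ∪ ↑S, fun w hw => ?_, hlab, fun v hv => ?_, fun v hv => ?_⟩
    · rw [← insert_union]
      exact ((hQ w).1 hw).imp (fun h => hC.queue_subset h.2) id
    · exact hv.elim (hC.feasible v) fun hv => (hfeas v hv).1
    · rw [← insert_union] at hv
      rcases hv with hv | hv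
      · rcases hC.expanded v hv with h | ⟨h1, h2⟩
        · by_cases hvu : v = u
          · subst hvu
            refine Or.inr ⟨hgoal, fun a ha => ?_⟩
            exact (hexp _ (mem_expand.2 ⟨a, ha, rfl⟩)).imp_left Or.inr
          · exact Or.inl ((hQ v).2 (Or.inl ⟨hvu, h⟩))
        · exact Or.inr ⟨h1, fun a ha =>
            (h2 a ha).imp Or.inl fun h => h.mono subset_union_left⟩
      · exact Or.inl ((hQ v).2 (Or.inr hv))

/-- The number of nodes of the search tree below the queue, up to a constant factor. -/
def queuePotential (D : Params m) (R : ℕ) (Q : Finset (Node m)) : ℕ :=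
  ∑ v ∈ Q, ((D.inputs R).card + 1) ^ (D.h R + 1 - v.length)

/-- With `K` inputs, the popped node of depth `l` weighs `(K + 1) ^ (h + 1 - l)`, while its at most
`K` children weigh `(K + 1) ^ (h - l)` each. The depth bound `h + 1` admits the root even when `h =
0`. -/
lemma Step.queuePotential_lt {s s' : LoopState m} (h : Step P D R s s')
    (hs : ∀ v ∈ s.1, v.length < D.h R + 1) :
    (∀ v ∈ s'.1, v.length < D.h R + 1) ∧
      queuePotential D R s'.1 < queuePotential D R s.1 := by
  classical
  obtain ⟨u, hu, -, S, hS, hQ, hfeas, -⟩ := h.spec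
  set K := (D.inputs R).card with hK
  refine ⟨fun v hv => ?_, ?_⟩
  · rcases (hQ v).1 hv with h | h
    · exact hs v h.2
    · exact (hfeas v h).2.trans (Nat.lt_succ_self _)
  · have hQ' : s'.1 = s.1.erase u ∪ S := by ext w; rw [hQ]; simp
    have hlen : ∀ w ∈ S, w.length = u.length + 1 := fun w hw => by
      obtain ⟨a, -, rfl⟩ := mem_expand.1 (hS hw)
      simp
    have hcard : S.card ≤ K := (Finset.card_le_card hS).trans Finset.card_image_le
    have hsum : queuePotential D R S ≤ K * (K + 1) ^ (D.h R - u.length) := by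
      rw [queuePotential, Finset.sum_congr rfl fun w hw => by
        rw [hlen w hw, Nat.add_sub_add_right], Finset.sum_const, smul_eq_mul]
      exact Nat.mul_le_mul_right _ hcard
    have hu' : D.h R + 1 - u.length = (D.h R - u.length) + 1 := by have := hs u hu; omega
    have hpos : 0 < (K + 1) ^ (D.h R - u.length) := by positivity
    calc queuePotential D R s'.1 ≤ queuePotential D R (s.1.erase u) + queuePotential D R S := by
          rw [hQ', queuePotential, queuePotential, queuePotential, ← Finset.sum_union_inter]
          exact Nat.le_add_right _ _
      _ < queuePotential D R (s.1.erase u) + (K + 1) ^ (D.h R + 1 - u.length) := by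
          rw [hu', pow_succ]
          nlinarith
      _ = queuePotential D R s.1 := Finset.sum_erase_add _ _ hu

lemma exists_step_or_returns (s : LoopState m) :
    (∃ s', Step P D R s s') ∨ ∃ z, Returns P D R s z := by
  rcases s.1.eq_empty_or_nonempty with h | h
  · exact Or.inr ⟨none, h⟩
  obtain ⟨u, hu, hmin⟩ := s.1.exists_min_image (nodeJ P D R) h
  by_cases hg : D.toSignal R u ∈ P.Ugoal
  · exact Or.inr ⟨some u, ⟨hu, hmin⟩, hg⟩
  · obtain ⟨⟨S, L⟩, h'⟩ :=
      exists_forLoop (P := P) (D := D) (R := R) (expand D R u).toList (expand D R u, s.2)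
    exact Or.inl ⟨(_, L), u, ⟨hu, hmin⟩, hg, _, by simp, S, h', rfl⟩

theorem alwaysTerminates (P : Problem n m) (D : Params m) (R : ℕ) : AlwaysTerminates P D R := by
  refine ⟨?_, fun s _ => exists_step_or_returns s⟩
  rintro ⟨s, h0, hstep⟩
  have hlen : ∀ k, ∀ v ∈ (s k).1, v.length < D.h R + 1 := by
    intro k
    induction k with
    | zero => simp [h0, initState]
    | succ k ih => exact ((hstep k).queuePotential_lt ih).1
  exact (WellFounded.not_rel_apply_succ (r := (· < ·)) fun k => queuePotential D R (s k).1)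
    |>.elim fun k hk => hk ((hstep k).queuePotential_lt (hlen k)).2

end

/-! ### Approximation of integrable signals by piecewise constant ones. -/

section

variable {n m : ℕ}

lemma tendsto_const_div_natCast_nhdsGT {c : ℝ} (hc : 0 < c) :
    Tendsto (fun R : ℕ => c / R) atTop (𝓝[>] 0) := by
  refine tendsto_nhdsWithin_iff.2 ⟨tendsto_const_div_atTop_nhds_zero_nat c, ?_⟩
  filter_upwards [eventually_gt_atTop 0] with R hR
  have : (0 : ℝ) < R := by exact_mod_cast hR
  exact div_pos hc this

/-- Integrable signals are limits almost everywhere of signals that are constant on the cells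
`[c i / R, c (i + 1) / R)`, with values in the sets `Ω_R`. -/
lemma exists_inputs_tendsto {Ω : Set (E m)} {inputs : ℕ → Finset (E m)} {c T : ℝ} (hc : 0 < c)
    (hT : 0 ≤ T) (hinputs : InputsDense Ω inputs) {u : ℝ → E m} (hu : IntegrableOn u (Icc 0 T))
    (huΩ : ∀ t ∈ Icc 0 T, u t ∈ Ω) :
    ∃ A : ℕ → ℕ → E m, (∀ᶠ R in atTop, ∀ i, A R i ∈ inputs R) ∧
      ∀ᵐ t, t ∈ Icc 0 T → Tendsto (fun R : ℕ => A R ⌊t * R / c⌋₊) atTop (𝓝 (u t)) := by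
  obtain ⟨hsub, hdisp⟩ := hinputs
  set U : ℝ → E m := (Icc 0 T).indicator u with hU
  have hUi : LocallyIntegrable U volume :=
    ((integrable_indicator_iff measurableSet_Icc).2 hu).locallyIntegrable
  -- The cell `[c i / R, c (i + 1) / R]` is written as a ball around its midpoint, as the Lebesgue
  -- differentiation theorem for non-centred balls requires.
  let avg : ℕ → ℕ → E m := fun R i =>
    ⨍ s in Metric.closedBall (c * (i + 1 / 2) / R) (c / 2 / R), U s
  have hne : ∀ᶠ R in atTop, (inputs R).Nonempty := by
    filter_upwards [hdisp 1 one_pos] with R hR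
    obtain ⟨w, hw, -⟩ := hR _ (huΩ 0 ⟨le_rfl, hT⟩)
    exact ⟨w, hw⟩
  -- The average need not lie in `Ω`, so a nearest point of `Ω_R` is taken.
  have hex : ∀ R i, ∃ a, (inputs R).Nonempty →
      a ∈ inputs R ∧ ∀ b ∈ inputs R, ‖a - avg R i‖ ≤ ‖b - avg R i‖ := by
    intro R i
    by_cases h : (inputs R).Nonempty
    · obtain ⟨a, ha⟩ := (inputs R).exists_min_image (fun b => ‖b - avg R i‖) h
      exact ⟨a, fun _ => ha⟩
    · exact ⟨0, fun h' => absurd h' h⟩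
  choose A hA using hex
  refine ⟨A, by filter_upwards [hne] with R hR i using (hA R i hR).1, ?_⟩
  filter_upwards [IsUnifLocDoublingMeasure.ae_tendsto_average (μ := volume) hUi 1] with t ht htT
  have hUt : U t = u t := indicator_of_mem htT _
  have hlim := ht (fun R : ℕ => c * (⌊t * R / c⌋₊ + 1 / 2) / R) (fun R : ℕ => c / 2 / R)
    (tendsto_const_div_natCast_nhdsGT (by positivity)) (by
      filter_upwards [eventually_gt_atTop 0] with R hR
      have hR' : (0 : ℝ) < R := by exact_mod_cast hR
      have h1 := Nat.floor_le (a := t * R / c) (by have := htT.1; positivity)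
      have h2 := Nat.lt_floor_add_one (t * R / c)
      rw [le_div_iff₀ hc] at h1
      rw [div_lt_iff₀ hc] at h2
      rw [Metric.mem_closedBall, Real.dist_eq, one_mul, abs_le]
      constructor
      · rw [neg_le_iff_add_nonneg, sub_add_eq_add_sub, sub_nonneg, ← sub_le_iff_le_add,
          ← sub_div, div_le_iff₀ hR']
        linarith
      · rw [sub_le_iff_le_add, ← add_div, le_div_iff₀ hR']
        linarith)
  rw [hUt, Metric.tendsto_nhds] at hlim
  rw [Metric.tendsto_nhds]
  intro ε hε
  filter_upwards [hlim (ε / 3) (by positivity), hdisp (ε / 3) (by positivity), hne]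
    with R h1 h2 h3
  obtain ⟨b, hb, hub⟩ := h2 _ (huΩ t htT)
  set i := ⌊t * R / c⌋₊
  -- `A R i` is no farther from the average than `b`, so its distance to `u t` is at most twice that
  -- of the average plus that of `b`: three thirds of `ε`.
  have h4 := (hA R i h3).2 b hb
  have h5 : dist (avg R i) (u t) < ε / 3 := h1
  rw [← dist_eq_norm] at hub
  rw [← dist_eq_norm, ← dist_eq_norm] at h4
  have h6 := dist_triangle (A R i) (avg R i) (u t)
  have h7 := dist_triangle (avg R i) (u t) b
  rw [dist_comm b] at h4
  linarith

/-- Convergence in `L¹` of a bounded function of time and input along such approximations. -/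
lemma tendsto_integral_norm_sub {Ω : Set (E m)} {A : ℕ → ℕ → E m} {c T B : ℝ} (hT : 0 ≤ T)
    (hA : ∀ᶠ R in atTop, ∀ i, A R i ∈ Ω) {u : ℝ → E m} (huΩ : ∀ t ∈ Icc 0 T, u t ∈ Ω)
    (hlim : ∀ᵐ t, t ∈ Icc 0 T → Tendsto (fun R : ℕ => A R ⌊t * R / c⌋₊) atTop (𝓝 (u t)))
    {Φ : ℝ → E m → E n} (hΦt : ∀ v ∈ Ω, Continuous fun t => Φ t v)
    (hΦv : ∀ t, ContinuousOn (Φ t) Ω) (hB : ∀ t, ∀ v ∈ Ω, ‖Φ t v‖ ≤ B)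
    (hΦu : IntervalIntegrable (fun t => Φ t (u t)) volume 0 T) :
    (∀ᶠ R : ℕ in atTop, IntervalIntegrable
      (fun t => ‖Φ t (u t) - Φ t (A R ⌊t * R / c⌋₊)‖) volume 0 T) ∧
    Tendsto (fun R : ℕ => ∫ t in (0 : ℝ)..T, ‖Φ t (u t) - Φ t (A R ⌊t * R / c⌋₊)‖)
      atTop (𝓝 0) := by
  have hsub : uIoc 0 T ⊆ Icc 0 T := by rw [uIoc_of_le hT]; exact Ioc_subset_Icc_self
  have hmeas : ∀ᶠ R : ℕ in atTop, Measurable fun t : ℝ => Φ t (A R ⌊t * R / c⌋₊) := by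
    filter_upwards [hA] with R hR
    -- Joint measurability of `Φ` is not assumed; the cell index is countable, so continuity in time
    -- for each input suffices.
    have h1 : Measurable fun p : ℝ × ℕ => Φ p.1 (A R p.2) :=
      measurable_from_prod_countable_left fun i => (hΦt _ (hR i)).measurable
    exact h1.comp (measurable_id.prodMk (Nat.measurable_floor.comp (by fun_prop)))
  have hmeas' : ∀ᶠ R : ℕ in atTop, AEStronglyMeasurable
      (fun t => ‖Φ t (u t) - Φ t (A R ⌊t * R / c⌋₊)‖) (volume.restrict (uIoc 0 T)) := by
    filter_upwards [hmeas] with R hR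
    exact (hΦu.def'.aestronglyMeasurable.sub hR.aestronglyMeasurable).norm
  have hbound : ∀ᶠ R : ℕ in atTop, ∀ t ∈ uIoc 0 T,
      ‖‖Φ t (u t) - Φ t (A R ⌊t * R / c⌋₊)‖‖ ≤ B + B := by
    filter_upwards [hA] with R hR t ht
    rw [norm_norm]
    exact (norm_sub_le _ _).trans (add_le_add (hB t _ (huΩ t (hsub ht))) (hB t _ (hR _)))
  constructor
  · filter_upwards [hmeas', hbound] with R h1 h2
    rw [intervalIntegrable_iff]
    refine Integrable.mono' (g := fun _ => B + B) (integrableOn_const (by simp)) h1 ?_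
    exact (ae_restrict_iff' measurableSet_uIoc).2 (Eventually.of_forall h2)
  · have := intervalIntegral.tendsto_integral_filter_of_dominated_convergence
      (f := fun _ => (0 : ℝ)) (fun _ => B + B) hmeas'
      (hbound.mono fun R h => Eventually.of_forall h) intervalIntegrable_const (by
        filter_upwards [hlim] with t ht htT
        have htT := hsub htT
        have h1 : Tendsto (fun R : ℕ => A R ⌊t * R / c⌋₊) atTop (𝓝[Ω] (u t)) :=
          tendsto_nhdsWithin_iff.2 ⟨ht htT, hA.mono fun R h => h _⟩
        have h2 := (hΦv t (u t) (huΩ t htT)).tendsto.comp h1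
        have h3 := (h2.const_sub (Φ t (u t))).norm
        rwa [sub_self, norm_zero] at h3)
    simpa using this

end

/-! ### Tracking a reference signal in spite of pruning. -/

section

variable {n m : ℕ} {P : Problem n m} {D : Params m} {R : ℕ} {M ρ : ℝ}
  {u : Signal m} {x : ℝ → E n} {a : ℕ → E m} {d : ℕ}

/-- Error in the dynamics when the input of `u` is replaced by `a i` on the `i`-th cell. -/
def dynamicsError (P : Problem n m) (D : Params m) (R : ℕ) (u : Signal m) (x : ℝ → E n)
    (a : ℕ → E m) (t : ℝ) : ℝ :=
  ‖P.f (x t) (u.val t) - P.f (x t) (a ⌊t * R / D.c⌋₊)‖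

/-- Error in the input when the input of `u` is replaced by `a i` on the `i`-th cell. -/
def inputError (D : Params m) (R : ℕ) (u : Signal m) (a : ℕ → E m) (t : ℝ) : ℝ :=
  ‖u.val t - a ⌊t * R / D.c⌋₊‖

/-- Bound for the deviation from `x` at time `t` after `k` replacements of a node by an equivalent
one. -/
def deviation (P : Problem n m) (D : Params m) (R : ℕ) (u : Signal m) (x : ℝ → E n)
    (a : ℕ → E m) (k : ℕ) (t : ℝ) : ℝ :=
  ((∫ s in (0 : ℝ)..t, dynamicsError P D R u x a s) + k * (Real.sqrt n / D.η R)) *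
    Real.exp (D.Lf * t)

/-- The path `x` of `u` has a tube of radius `2ρ` in `Xfree` around it, and up to time `d c / R` the
inputs `a` approximate `u` so well that the deviation is at most `ρ`. -/
structure IsReference (P : Problem n m) (D : Params m) (R : ℕ) (M : ℝ) (u : Signal m)
    (x : ℝ → E n) (a : ℕ → E m) (d : ℕ) (ρ : ℝ) : Prop where
  isPath : P.IsPath u x
  continuous : Continuous x
  radius_nonneg : 0 ≤ ρ
  tube : ∀ t, Metric.closedBall (x t) (2 * ρ) ⊆ P.Xfree
  mem_inputs : ∀ i, a i ∈ D.inputs R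
  dur_le : D.c * d / R ≤ u.dur
  integrable_dynamicsError : IntervalIntegrable (dynamicsError P D R u x a) volume 0 u.dur
  integrable_inputError : IntervalIntegrable (inputError D R u a) volume 0 u.dur
  deviation_le : deviation P D R u x a d u.dur ≤ ρ
  step_le : M * (D.c / R) ≤ ρ

lemma IsReference.mem_Xfree (h : IsReference P D R M u x a d ρ) (t : ℝ) : x t ∈ P.Xfree :=
  h.tube t (Metric.mem_closedBall_self (by linarith [h.radius_nonneg]))

lemma IsReference.deviation_mono (h : IsReference P D R M u x a d ρ) (hLf : 0 ≤ D.Lf)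
    (hη : 0 < D.η R) {k l : ℕ} {s t : ℝ} (hkl : k ≤ l) (hs : 0 ≤ s) (hst : s ≤ t)
    (ht : t ≤ u.dur) : deviation P D R u x a k s ≤ deviation P D R u x a l t := by
  have h0 : 0 ≤ Real.sqrt n / D.η R := by positivity
  have h1 : 0 ≤ ∫ r in (0 : ℝ)..t, dynamicsError P D R u x a r :=
    intervalIntegral.integral_nonneg (hs.trans hst) fun _ _ => norm_nonneg _
  refine mul_le_mul (add_le_add ?_ ?_) ?_ (Real.exp_pos _).le (by positivity)
  · refine intervalIntegral.integral_mono_interval le_rfl hs hst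
      (Eventually.of_forall fun _ => norm_nonneg _) (h.integrable_dynamicsError.mono_set ?_)
    rw [uIcc_of_le (hs.trans hst), uIcc_of_le ((hs.trans hst).trans ht)]
    exact Icc_subset_Icc le_rfl ht
  · exact mul_le_mul_of_nonneg_right (by exact_mod_cast hkl) h0
  · exact Real.exp_le_exp.2 (mul_le_mul_of_nonneg_left hst hLf)

/-- The node `v` of depth at most `k` ends close to the state of `x` at time `k c / R`, at about the
cost of `u` up to that time. -/
structure Tracks (P : Problem n m) (D : Params m) (R : ℕ) (u : Signal m)
    (x : ℝ → E n) (a : ℕ → E m) (d k : ℕ) (v : Node m) : Prop where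
  length_le : v.length ≤ k
  dist_le : ‖endState P D R v - x (D.c * k / R)‖ ≤ deviation P D R u x a k (D.c * k / R)
  cost_le : nodeJ P D R v ≤ (∫ t in (0 : ℝ)..(D.c * k / R), P.g (x t) (u.val t)) +
    D.Lg * ((∫ t in (0 : ℝ)..(D.c * k / R), inputError D R u a t) +
      D.c * k / R * deviation P D R u x a d u.dur)

lemma floor_mul_div_of_mem_Ioo {c : ℝ} (hc : 0 < c) (hR : 0 < R) {k : ℕ} {t : ℝ}
    (ht : t ∈ Ioo (c * k / R) (c * k / R + c / R)) : ⌊t * R / c⌋₊ = k := by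
  have hR' : (0 : ℝ) < R := by exact_mod_cast hR
  have h1 := ht.1
  have h2 := ht.2
  rw [div_lt_iff₀ hR'] at h1
  rw [← add_div, lt_div_iff₀ hR'] at h2
  have h0 : 0 ≤ t * R := le_trans (by positivity) h1.le
  rw [Nat.floor_eq_iff (by positivity), le_div_iff₀ hc, div_lt_iff₀ hc]
  constructor <;> linarith

/-- The child for the input `a k` of a node that tracks up to step `k`. The last two bounds leave
room for a replacement of that child by an equivalent node. -/
lemma Tracks.append (h : IsReference P D R M u x a d ρ) (hA1 : IsOpen P.Xfree)
    (hLf : 0 ≤ D.Lf) (hM : 0 ≤ M) (hLg : 0 ≤ D.Lg) (hc : 0 < D.c) (hR : 0 < R) (hη : 0 < D.η R)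
    (hinputs : (D.inputs R : Set (E m)) ⊆ P.Ω)
    (hA2 : P.DynamicsBounds D.Lf M) (hA3 : P.CostLipschitz D.Lg) {k : ℕ} (hk : k < d)
    {v : Node m} (hv : FeasibleNode P D R v) (ht : Tracks P D R u x a d k v) :
    D.toSignal R (v ++ [a k]) ∈ P.Ufeas ∧
    ‖endState P D R (v ++ [a k]) - x (D.c * (k + 1 : ℕ) / R)‖ ≤
      deviation P D R u x a k (D.c * (k + 1 : ℕ) / R) ∧
    nodeJ P D R (v ++ [a k]) ≤ (∫ t in (0 : ℝ)..(D.c * (k + 1 : ℕ) / R), P.g (x t) (u.val t)) +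
      D.Lg * ((∫ t in (0 : ℝ)..(D.c * (k + 1 : ℕ) / R), inputError D R u a t) +
        D.c * (k + 1 : ℕ) / R * deviation P D R u x a d u.dur) := by
  have hR' : (0 : ℝ) < R := by exact_mod_cast hR
  set Δ := D.c / R with hΔdef
  set t₀ := D.c * k / R with ht₀def
  have hΔ : 0 < Δ := by positivity
  have ht₀ : 0 ≤ t₀ := by positivity
  have ht₁ : D.c * (k + 1 : ℕ) / R = t₀ + Δ := by rw [ht₀def, hΔdef]; push_cast; ring
  have ht₁T : t₀ + Δ ≤ u.dur := by
    rw [← ht₁]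
    refine le_trans ?_ h.dur_le
    have : ((k + 1 : ℕ) : ℝ) ≤ d := by exact_mod_cast hk
    gcongr
  have ht₀T : t₀ ≤ u.dur := by linarith
  rw [ht₁]
  obtain ⟨-, hFi, hxe⟩ := h.isPath.isTrajectory
  have hxic : P.xic ∈ P.Xfree := by
    have := hxe 0 ⟨le_rfl, h.isPath.dur_nonneg⟩
    rw [intervalIntegral.integral_same, add_zero] at this
    exact this ▸ h.mem_Xfree 0
  have sub {p q : ℝ} (hp : 0 ≤ p) (hpq : p ≤ q) (hq : q ≤ u.dur) :
      uIcc p q ⊆ uIcc 0 u.dur := by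
    rw [uIcc_of_le hpq, uIcc_of_le h.isPath.dur_nonneg]
    exact Icc_subset_Icc hp hq
  have s01 := sub le_rfl ht₀ ht₀T
  have s12 := sub ht₀ (by linarith : t₀ ≤ t₀ + Δ) ht₁T
  have ha : a k ∈ P.Ω := hinputs (h.mem_inputs k)
  set dev := deviation P D R u x a d u.dur
  have hdev₀ : deviation P D R u x a k t₀ ≤ dev :=
    h.deviation_mono hLf hη hk.le ht₀ ht₀T le_rfl
  have hdev₁ : deviation P D R u x a k (t₀ + Δ) ≤ dev :=
    h.deviation_mono hLf hη hk.le (by linarith) ht₁T le_rfl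
  -- A deviation of at most `ρ` in a tube of radius `2ρ` leaves a free ball of radius `ρ`, which a
  -- single step cannot leave.
  have hball : Metric.closedBall (endState P D R v) ρ ⊆ P.Xfree := by
    refine (Metric.closedBall_subset_closedBall' ?_).trans (h.tube t₀)
    rw [dist_eq_norm]
    linarith [ht.dist_le.trans (hdev₀.trans h.deviation_le)]
  obtain ⟨Y, hYc, hYX, hY⟩ := exists_constant_input_solution hLf hM hA2 ha h.radius_nonneg hΔ.le
    hball h.step_le
  obtain ⟨hfeas, hend, hJ⟩ := hv.append hxic hA1 hLf hLg hA2 hA3 hc hR ha hYc hYX hY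
  have hxshift : ∀ t ∈ Icc 0 Δ, x (t₀ + t) = x t₀ +
      ∫ s in t₀..(t₀ + t), P.f (x s) (u.val s) := fun t htΔ => by
    rw [hxe (t₀ + t) ⟨by linarith [htΔ.1], by linarith [htΔ.2]⟩, hxe t₀ ⟨ht₀, ht₀T⟩, add_assoc,
      intervalIntegral.integral_add_adjacent_intervals (hFi.mono_set s01)
        (hFi.mono_set (sub ht₀ (by linarith [htΔ.1]) (by linarith [htΔ.2])))]
  have herr : ∫ s in t₀..(t₀ + Δ), ‖P.f (x s) (u.val s) - P.f (x s) (a k)‖ =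
      ∫ s in t₀..(t₀ + Δ), dynamicsError P D R u x a s := by
    refine intervalIntegral.integral_congr_uIoo fun s hs => ?_
    rw [uIoo_of_le (by linarith)] at hs
    simp only [dynamicsError, floor_mul_div_of_mem_Ioo hc hR hs]
  have hYx : ∀ t ∈ Icc 0 Δ, ‖Y t - x (t₀ + t)‖ ≤ deviation P D R u x a k (t₀ + Δ) := by
    intro t htΔ
    refine (norm_sub_le_of_constant_input hLf hA2 ha hYc hYX hY h.continuous h.mem_Xfree
      (hFi.mono_set s12) hxshift ht.dist_le t htΔ).trans ?_
    have hnn : 0 ≤ ∫ s in t₀..(t₀ + Δ), dynamicsError P D R u x a s :=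
      intervalIntegral.integral_nonneg (by linarith) fun _ _ => norm_nonneg _
    -- The step amplifies its own dynamics error only by `exp (Lf Δ)`; `deviation` grants it `exp
    -- (Lf (t₀ + Δ))`.
    have hexp : 1 ≤ Real.exp (D.Lf * t₀) := Real.one_le_exp (by positivity)
    rw [herr, deviation, deviation, mul_add D.Lf t₀ Δ, Real.exp_add, ← mul_assoc,
      ← intervalIntegral.integral_add_adjacent_intervals
        (h.integrable_dynamicsError.mono_set s01) (h.integrable_dynamicsError.mono_set s12)]
    refine mul_le_mul_of_nonneg_right ?_ (Real.exp_pos _).le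
    nlinarith
  refine ⟨hfeas, by rw [hend]; exact hYx Δ ⟨hΔ.le, le_rfl⟩, ?_⟩
  have hgi := h.isPath.intervalIntegrable_cost hLg hA3
  have hgY : Continuous fun s => P.g (Y (s - t₀)) (a k) :=
    hA3.continuous_cost hLg ha (hYc.comp (continuous_sub_right t₀)) fun _ => hYX _
  -- The node `v` may be shorter than `k` steps, so its next step is shifted in time onto `[t₀, t₀ +
  -- Δ]`.
  have hbound : ∫ t in (0 : ℝ)..Δ, P.g (Y t) (a k) ≤
      ∫ t in t₀..(t₀ + Δ), (P.g (x t) (u.val t) + D.Lg * (inputError D R u a t + dev)) := by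
    have e := intervalIntegral.integral_comp_sub_right (a := t₀) (b := t₀ + Δ)
      (fun s => P.g (Y s) (a k)) t₀
    rw [sub_self, add_sub_cancel_left] at e
    rw [← e]
    refine intervalIntegral.integral_mono_on_of_le_Ioo (by linarith)
      (hgY.intervalIntegrable _ _) ((hgi.mono_set s12).add
        (((h.integrable_inputError.mono_set s12).add intervalIntegrable_const).const_mul _))
      fun t htt => ?_
    have hu : u.val t ∈ P.Ω := h.isPath.val_mem t ⟨by linarith [htt.1], by linarith [htt.2]⟩
    have h1 := (le_abs_self _).trans
      (hA3.abs_sub_le hLg (hYX (t - t₀)) (h.mem_Xfree t) ha hu)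
    have h2 := hYx (t - t₀) ⟨by linarith [htt.1], by linarith [htt.2]⟩
    rw [add_sub_cancel] at h2
    rw [inputError, floor_mul_div_of_mem_Ioo hc hR htt, norm_sub_rev (u.val t)]
    have h3 := mul_le_mul_of_nonneg_left (h2.trans hdev₁) hLg
    rw [mul_add] at h1
    rw [mul_add]
    linarith
  rw [intervalIntegral.integral_add (hgi.mono_set s12)
      (((h.integrable_inputError.mono_set s12).add intervalIntegrable_const).const_mul _),
    intervalIntegral.integral_const_mul,
    intervalIntegral.integral_add (h.integrable_inputError.mono_set s12) intervalIntegrable_const,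
    intervalIntegral.integral_const, add_sub_cancel_left, smul_eq_mul] at hbound
  rw [hJ, ← intervalIntegral.integral_add_adjacent_intervals (hgi.mono_set s01)
    (hgi.mono_set s12), ← intervalIntegral.integral_add_adjacent_intervals
    (h.integrable_inputError.mono_set s01) (h.integrable_inputError.mono_set s12)]
  have := ht.cost_le
  calc _ ≤ _ := add_le_add this hbound
    _ = _ := by ring

/-- This is `e^y ≥ 1 + y`. It makes the margin in `Prec` nonnegative and reduces the partition
condition to `R / η → 0`. -/
lemma le_expQuot {L : ℝ} (hL : 0 ≤ L) (t : ℝ) : t ≤ expQuot L t := by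
  rw [expQuot]
  split_ifs with h
  · exact le_rfl
  · have hL' : 0 < L := lt_of_le_of_ne hL (Ne.symm h)
    rw [le_div_iff₀ hL']
    linarith [Real.add_one_le_exp (L * t)]

/-- As long as the method has not returned, the queue contains a node that costs little more than
the signal `u`. -/
lemma Reachable.exists_mem_queue (h : IsReference P D R M u x a d ρ) (hA1 : IsOpen P.Xfree)
    (hLf : 0 ≤ D.Lf) (hM : 0 ≤ M) (hLg : 0 ≤ D.Lg) (hc : 0 < D.c) (hR : 0 < R) (hη : 0 < D.η R)
    (hinputs : (D.inputs R : Set (E m)) ⊆ P.Ω)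
    (hA2 : P.DynamicsBounds D.Lf M) (hA3 : P.CostLipschitz D.Lg) (hA4 : P.PositiveCost)
    (hu : u ∈ P.Ufeas) (hd : 0 < d) (hdh : d < D.h R)
    (hgoal : Metric.closedBall (x (D.c * d / R)) ρ ⊆ P.Xgoal)
    {s : LoopState m} (hs : Reachable P D R s) :
    ∃ v ∈ s.1, nodeJ P D R v ≤ P.J P.xic u +
      D.Lg * ((∫ t in (0 : ℝ)..u.dur, inputError D R u a t) +
        u.dur * deviation P D R u x a d u.dur) := by
  classical
  have hR' : (0 : ℝ) < R := by exact_mod_cast hR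
  obtain ⟨C, hC⟩ := hs.exists_isExploredSet
  have hT := h.isPath.dur_nonneg
  set dev := deviation P D R u x a d u.dur with hdev
  have hcell : 0 ≤ Real.sqrt n / D.η R := by positivity
  have hx0 := h.isPath.isTrajectory.2.2 0 ⟨le_rfl, hT⟩
  rw [intervalIntegral.integral_same, add_zero] at hx0
  have hxic : P.xic ∈ P.Xfree := hx0 ▸ h.mem_Xfree 0
  have hroot : Tracks P D R u x a d 0 [] := by
    refine ⟨le_rfl, ?_, by simp⟩
    rw [endState_nil hxic hA1 hLf hA2]
    simp [hx0, deviation]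
  let good : ℕ → Prop := fun k => ∃ v, (v ∈ C ∨ k = 0 ∧ v = []) ∧ Tracks P D R u x a d k v
  have hgood0 : good 0 := ⟨[], Or.inr ⟨rfl, rfl⟩, hroot⟩
  -- For the greatest `k` reached by a tracking node in `C` (or by the root, if `k = 0`), that node
  -- must still be queued: if expanded, it would yield a tracking node for `k + 1`, or it would be a
  -- goal node when `k = d`.
  set k := Nat.findGreatest good d with hkdef
  have hkgood : good k := Nat.findGreatest_spec (Nat.zero_le d) hgood0
  have hkd : k ≤ d := Nat.findGreatest_le d
  obtain ⟨v, hvC, hv⟩ := hkgood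
  have htk : D.c * k / R ≤ u.dur := by
    refine le_trans ?_ h.dur_le
    have : (k : ℝ) ≤ d := by exact_mod_cast hkd
    gcongr
  have htk0 : 0 ≤ D.c * k / R := by positivity
  have hdev0 : 0 ≤ dev := by
    refine mul_nonneg (add_nonneg ?_ (by positivity)) (Real.exp_pos _).le
    exact intervalIntegral.integral_nonneg hT fun _ _ => norm_nonneg _
  refine ⟨v, ?_, hv.cost_le.trans (add_le_add ?_ (mul_le_mul_of_nonneg_left
    (add_le_add ?_ (mul_le_mul_of_nonneg_right htk hdev0)) hLg))⟩
  · rcases hC.expanded v (hvC.elim Or.inr fun h => Or.inl h.2) with hQ | ⟨hng, hexp⟩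
    · exact hQ
    exfalso
    rcases hkd.lt_or_eq with hlt | heq
    · have hmax : ¬ good (k + 1) := Nat.findGreatest_is_greatest (Nat.lt_succ_self _) hlt
      have hfeas : FeasibleNode P D R v := hvC.elim (fun h => Or.inr (hC.feasible v h))
        fun h => Or.inl h.2
      obtain ⟨h1, h2, h3⟩ := Tracks.append h hA1 hLf hM hLg hc hR hη hinputs hA2 hA3 hlt hfeas hv
      have htk1 : 0 ≤ D.c * (k + 1 : ℕ) / R := by positivity
      have hlen : (v ++ [a k]).length ≤ k + 1 := by simpa using hv.length_le
      -- Passing from `k` to `k + 1` in `deviation` makes room for one cell diameter, the price of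
      -- replacing the child by its pruner.
      have hdev1 : deviation P D R u x a k (D.c * (k + 1 : ℕ) / R) + Real.sqrt n / D.η R ≤
          deviation P D R u x a (k + 1) (D.c * (k + 1 : ℕ) / R) := by
        have hexp : 1 ≤ Real.exp (D.Lf * (D.c * (k + 1 : ℕ) / R)) :=
          Real.one_le_exp (by positivity)
        simp only [deviation]
        push_cast at hexp ⊢
        nlinarith
      rcases hexp (a k) (h.mem_inputs k) with hw | hw | hw | ⟨z, hz, hzw⟩
      · exact hmax ⟨_, Or.inl hw, hlen, by linarith, h3⟩
      · exact hw h1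
      · omega
      · refine hmax ⟨z, Or.inl hz, ?_, ?_, le_trans ?_ h3⟩
        · have := hzw.2.1
          rw [toSignal_dur, toSignal_dur, div_le_div_iff_of_pos_right hR',
            mul_le_mul_iff_right₀ hc] at this
          exact (by exact_mod_cast this : z.length ≤ _).trans hlen
        · calc _ ≤ _ := norm_sub_le_norm_sub_add_norm_sub _ (endState P D R (v ++ [a k])) _
            _ ≤ _ := by linarith [hzw.1.norm_sub_le hη]
        · have h4 := hzw.2.2
          have h5 : 0 ≤ expQuot D.Lf ((D.h R : ℝ) / R) :=
            le_trans (by positivity) (le_expQuot hLf _)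
          -- Only the sign of the margin matters here: the pruner costs no more than the pruned
          -- child.
          have : 0 ≤ Real.sqrt n / D.η R * (D.Lg * expQuot D.Lf ((D.h R : ℝ) / R)) := by
            positivity
          linarith
    · have hvC' : v ∈ C := hvC.resolve_right fun h => by omega
      refine hng ⟨hC.feasible v hvC', hgoal ?_⟩
      rw [Metric.mem_closedBall, dist_eq_norm, ← heq]
      refine hv.dist_le.trans ((h.deviation_mono hLf hη hkd htk0 htk le_rfl).trans ?_)
      exact h.deviation_le
  · rcases eq_or_lt_of_le htk0 with h0 | hpos
    · rw [← h0, intervalIntegral.integral_same]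
      exact (hA4.1 u hu).le
    · have := hA4.2 u hu _ ⟨hpos, htk⟩
      rwa [(h.isPath.trunc ⟨htk0, htk⟩).J_eq hA1 hLf hA2] at this
  · refine intervalIntegral.integral_mono_interval le_rfl htk0 htk
      (Eventually.of_forall fun _ => norm_nonneg _) h.integrable_inputError

/-- The output of the method costs little more than the signal `u`. -/
lemma IsOutput.cost_le (h : IsReference P D R M u x a d ρ) (hA1 : IsOpen P.Xfree)
    (hLf : 0 ≤ D.Lf) (hM : 0 ≤ M) (hLg : 0 ≤ D.Lg) (hc : 0 < D.c) (hR : 0 < R) (hη : 0 < D.η R)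
    (hinputs : (D.inputs R : Set (E m)) ⊆ P.Ω)
    (hA2 : P.DynamicsBounds D.Lf M) (hA3 : P.CostLipschitz D.Lg) (hA4 : P.PositiveCost)
    (hu : u ∈ P.Ufeas) (hd : 0 < d) (hdh : d < D.h R)
    (hgoal : Metric.closedBall (x (D.c * d / R)) ρ ⊆ P.Xgoal)
    {w : Option (Signal m)} (hw : IsOutput P D R w) :
    P.cost w ≤ ((P.J P.xic u + D.Lg * ((∫ t in (0 : ℝ)..u.dur, inputError D R u a t) +
        u.dur * deviation P D R u x a d u.dur) : ℝ) : EReal) := by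
  obtain ⟨s, z, hs, hret, rfl⟩ := hw
  obtain ⟨v, hv, hvle⟩ := hs.exists_mem_queue h hA1 hLf hM hLg hc hR hη hinputs hA2 hA3 hA4 hu hd
    hdh hgoal
  cases z with
  | none =>
    have hempty : s.1 = ∅ := hret
    simp [hempty] at hv
  | some z => exact EReal.coe_le_coe_iff.2 ((hret.1.2 v hv).trans hvle)

lemma IsOutput.mem_Ugoal {w : Option (Signal m)} (hw : IsOutput P D R w) {y : Signal m}
    (hy : w = some y) : y ∈ P.Ugoal := by
  obtain ⟨s, z, -, hret, rfl⟩ := hw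
  cases z with
  | none => simp at hy
  | some z =>
    obtain rfl : D.toSignal R z = y := by simpa using hy
    exact hret.2

end

/-! ### The limit of infinite resolution. -/

variable {n m : ℕ} {P : Problem n m} {D : Params m} {M : ℝ}

lemma Problem.IsPath.congr {u : Signal m} {x y : ℝ → E n} (hx : P.IsPath u x)
    (h : EqOn y x (Icc 0 u.dur)) : P.IsPath u y := by
  obtain ⟨hxc, hxi, hxe⟩ := hx.isTrajectory
  have e {t : ℝ} (ht : t ∈ Icc 0 u.dur) :
      EqOn (fun s => P.f (x s) (u.val s)) (fun s => P.f (y s) (u.val s)) (uIcc 0 t) := by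
    intro s hs
    rw [uIcc_of_le ht.1] at hs
    simp only [h ⟨hs.1, hs.2.trans ht.2⟩]
  refine ⟨hx.dur_nonneg, hx.integrableOn_val, hx.val_mem, ⟨hxc.congr h,
    hxi.congr ((e ⟨hx.dur_nonneg, le_rfl⟩).mono uIoc_subset_uIcc), fun t ht => ?_⟩,
    fun t ht => h ht ▸ hx.mem_Xfree t ht⟩
  rw [h ht, hxe t ht, intervalIntegral.integral_congr (e ht)]

/-- A feasible signal has a path that is continuous on the whole real line and has a tube in
`Xfree` around it. -/
lemma exists_path_tube (hA1 : IsOpen P.Xfree) {u : Signal m} (hu : u ∈ P.Ufeas) :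
    ∃ x, P.IsPath u x ∧ Continuous x ∧ x u.dur = P.sysMap P.xic u u.dur ∧
      ∃ r > 0, ∀ t, Metric.closedBall (x t) r ⊆ P.Xfree := by
  have hx := isPath_sysMap_of_mem_Ufeas hu
  have hT := hx.dur_nonneg
  set y := P.sysMap P.xic u
  have hc : Continuous (IccExtend hT ((Icc 0 u.dur).domRestrict y)) :=
    hx.isTrajectory.1.domRestrict.Icc_extend'
  have he : EqOn (IccExtend hT ((Icc 0 u.dur).domRestrict y)) y (Icc 0 u.dur) := fun t ht => by
    rw [IccExtend_of_mem hT _ ht, Set.domRestrict_apply]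
  have hK : IsCompact (y '' Icc 0 u.dur) := isCompact_Icc.image_of_continuousOn hx.isTrajectory.1
  obtain ⟨r, hr, hsub⟩ := hK.exists_cthickening_subset_open hA1
    (by rintro _ ⟨t, ht, rfl⟩; exact hx.mem_Xfree t ht)
  refine ⟨_, hx.congr he, hc, he ⟨hT, le_rfl⟩, r, hr, fun t => ?_⟩
  exact (Metric.closedBall_subset_cthickening
    (mem_image_of_mem y (projIcc 0 u.dur hT t).2) r).trans hsub

/-- The cells of the partition become small compared to the time step. -/
lemma tendsto_natCast_div_scaling (hLf : 0 ≤ D.Lf) (hh : HorizonScaling D.h)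
    (hη : PartitionScaling D.Lf D.h D.η) :
    Tendsto (fun R : ℕ => (R : ℝ) / D.η R) atTop (𝓝 0) := by
  refine squeeze_zero' (Eventually.of_forall fun R => by have := hη.1 R; positivity) ?_ hη.2
  filter_upwards [hh.1, hh.2.eventually (gt_mem_nhds one_pos), eventually_gt_atTop 0]
    with R h1 h2 h3
  have h1' : (0 : ℝ) < D.h R := by exact_mod_cast h1
  have h3' : (0 : ℝ) < R := by exact_mod_cast h3
  -- Once `h ≥ R`, the factor `expQuot` is at least `1` and can be dropped.
  have h4 : 1 ≤ (D.h R : ℝ) / R := by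
    rw [div_lt_one h1'] at h2
    rw [le_div_iff₀ h3']; linarith
  have h5 := h4.trans (le_expQuot hLf _)
  have := hη.1 R
  exact le_mul_of_one_le_right (by positivity) h5

/-- The outputs of the method are asymptotically at least as good as any given signal in
`𝒰_goal`. -/
lemma eventually_cost_le (hΩ : Bornology.IsBounded P.Ω)
    (hfu : ∀ x ∈ P.Xfree, ContinuousOn (fun v => P.f x v) P.Ω)
    (hLf : 0 ≤ D.Lf) (hM : 0 ≤ M) (hLg : 0 ≤ D.Lg) (hc : 0 < D.c)
    (hA1 : P.OpenConstraints) (hA2 : P.DynamicsBounds D.Lf M) (hA3 : P.CostLipschitz D.Lg)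
    (hA4 : P.PositiveCost) (hinputs : InputsDense P.Ω D.inputs) (hh : HorizonScaling D.h)
    (hη : PartitionScaling D.Lf D.h D.η) {w : ℕ → Option (Signal m)}
    (hw : ∀ R : ℕ, 0 < R → IsOutput P D R (w R)) {u : Signal m} (hu : u ∈ P.Ugoal) :
    ∃ err : ℕ → ℝ, Tendsto err atTop (𝓝 0) ∧
      ∀ᶠ R in atTop, P.cost (w R) ≤ ((P.J P.xic u + err R : ℝ) : EReal) := by
  obtain ⟨hufeas, hugoal⟩ := hu
  have ⟨⟨hT, hui, huΩ⟩, _, _⟩ := hufeas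
  set T := u.dur with hTdef
  obtain ⟨x, hx, hxc, hxT, r, hr, htube⟩ := exists_path_tube hA1.1 hufeas
  have hxX : ∀ t, x t ∈ P.Xfree := fun t => htube t (Metric.mem_closedBall_self hr.le)
  rw [← hxT] at hugoal
  obtain ⟨r', hr', hgoal⟩ := Metric.nhds_basis_closedBall.mem_iff.1 (hA1.2.mem_nhds hugoal)
  -- `2ρ ≤ r` fits the tube into `Xfree`. `2ρ ≤ r'` allows `ρ` for the deviation and `ρ` for the
  -- distance from `x (c d / R)` to `x T`.
  set ρ := min (r / 2) (r' / 2) with hρdef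
  have hρ : 0 < ρ := by positivity
  have hρr : 2 * ρ ≤ r := by linarith [min_le_left (r / 2) (r' / 2)]
  have hρr' : 2 * ρ ≤ r' := by linarith [min_le_right (r / 2) (r' / 2)]
  obtain ⟨A, hAin, hAlim⟩ := exists_inputs_tendsto hc hT.le hinputs hui huΩ
  have hAΩ : ∀ᶠ R in atTop, ∀ i, A R i ∈ P.Ω := hAin.mono fun R h i => hinputs.1 R (h i)
  obtain ⟨B, hB⟩ := hΩ.exists_norm_le
  obtain ⟨hfint, hflim⟩ := tendsto_integral_norm_sub hT.le hAΩ huΩ hAlim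
    (Φ := fun t v => P.f (x t) v) (fun v hv => continuous_dynamics hLf hA2 hv hxc hxX)
    (fun t => hfu _ (hxX t)) (fun t v hv => hA2.2 _ (hxX t) v hv) hx.isTrajectory.2.1
  obtain ⟨huint, hulim⟩ := tendsto_integral_norm_sub hT.le hAΩ huΩ hAlim
    (Φ := fun _ v => v) (fun v _ => continuous_const) (fun _ => continuousOn_id)
    (fun _ v hv => hB v hv) ((intervalIntegrable_iff_integrableOn_Icc_of_le hT.le).2 hui)
  -- The number of whole time steps that fit into `[0, T]`; the remainder is shorter than `c / R`.
  set d : ℕ → ℕ := fun R => ⌊T / D.c * R⌋₊ with hd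
  have hTc : 0 < T / D.c := by positivity
  have hdR : Tendsto (fun R : ℕ => (d R : ℝ) / R) atTop (𝓝 (T / D.c)) :=
    (tendsto_nat_floor_mul_div_atTop hTc.le).comp tendsto_natCast_atTop_atTop
  have hdle : ∀ R : ℕ, (d R : ℝ) ≤ T / D.c * R := fun R => Nat.floor_le (by positivity)
  have htime : Tendsto (fun R : ℕ => D.c * d R / R) atTop (𝓝 T) := by
    have := hdR.const_mul D.c
    rw [mul_div_cancel₀ _ hc.ne'] at this
    simpa only [mul_div_assoc] using this
  have hcells : Tendsto (fun R : ℕ => (d R : ℝ) * (Real.sqrt n / D.η R)) atTop (𝓝 0) := by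
    have := (tendsto_natCast_div_scaling hLf hh hη).const_mul (T / D.c * Real.sqrt n)
    rw [mul_zero] at this
    refine squeeze_zero (fun R => by have := hη.1 R; positivity) (fun R => ?_) this
    have := hη.1 R
    calc _ ≤ T / D.c * R * (Real.sqrt n / D.η R) :=
          mul_le_mul_of_nonneg_right (hdle R) (by positivity)
      _ = _ := by ring
  have hdev : Tendsto (fun R => deviation P D R u x (A R) (d R) T) atTop (𝓝 0) := by
    have := (hflim.add hcells).mul_const (Real.exp (D.Lf * T))
    rwa [add_zero, zero_mul] at this
  refine ⟨fun R => D.Lg * ((∫ t in (0 : ℝ)..T, inputError D R u (A R) t) +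
    T * deviation P D R u x (A R) (d R) T), ?_, ?_⟩
  · have := (hulim.add (hdev.const_mul T)).const_mul D.Lg
    rwa [mul_zero, add_zero, mul_zero] at this
  have hstep : Tendsto (fun R : ℕ => M * (D.c / R)) atTop (𝓝 0) := by
    simpa using (tendsto_const_div_atTop_nhds_zero_nat D.c).const_mul M
  have hend : Tendsto (fun R : ℕ => x (D.c * d R / R)) atTop (𝓝 (x T)) :=
    (hxc.tendsto T).comp htime
  filter_upwards [hAin, hfint, huint, hdev.eventually (gt_mem_nhds hρ),
    hstep.eventually (gt_mem_nhds hρ), hend.eventually (Metric.closedBall_mem_nhds _ hρ),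
    hdR.eventually (lt_mem_nhds hTc), hh.1, hh.2.eventually (gt_mem_nhds (inv_pos.2 hTc)),
    eventually_gt_atTop 0] with R h1 h2 h3 h4 h5 h6 h7 h8 h9 hR
  have hR' : (0 : ℝ) < R := by exact_mod_cast hR
  have h8' : (0 : ℝ) < D.h R := by exact_mod_cast h8
  refine (hw R hR).cost_le (d := d R) (x := x) (a := A R) (ρ := ρ)
    ⟨hx, hxc, hρ.le, fun t => (Metric.closedBall_subset_closedBall hρr).trans (htube t), h1, ?_,
      h2, h3, h4.le, h5.le⟩
    hA1.1 hLf hM hLg hc hR (hη.1 R) (hinputs.1 R) hA2 hA3 hA4 hufeas ?_ ?_ ?_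
  · rw [div_le_iff₀ hR']
    have := mul_le_mul_of_nonneg_left (hdle R) hc.le
    calc _ ≤ _ := this
      _ = T * R := by rw [← mul_assoc, mul_div_cancel₀ _ hc.ne']
  · by_contra h0
    have : d R = 0 := by omega
    simp [this] at h7
  -- `R / h < c / T` says that the horizon exceeds the `T R / c` steps needed.
  · rw [div_lt_iff₀ h8', ← div_eq_inv_mul, lt_div_iff₀ hTc] at h9
    have : (d R : ℝ) < D.h R := (hdle R).trans_lt (by linarith)
    exact_mod_cast this
  · refine (Metric.closedBall_subset_closedBall' ?_).trans hgoal
    have := Metric.mem_closedBall.1 h6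
    linarith

end

end GLC

theorem theorem1 {n m : ℕ} (P : GLC.Problem n m) (D : GLC.Params m) (M : ℝ)
    (hΩ : Bornology.IsBounded P.Ω)
    (hfu : ∀ x ∈ P.Xfree, ContinuousOn (fun v => P.f x v) P.Ω)
    (hLf : 0 ≤ D.Lf) (hM : 0 ≤ M) (hLg : 0 ≤ D.Lg) (hc : 0 < D.c)
    (hA1 : P.OpenConstraints)
    (hA2 : P.DynamicsBounds D.Lf M)
    (hA3 : P.CostLipschitz D.Lg)
    (hA4 : P.PositiveCost)
    (hinputs : GLC.InputsDense P.Ω D.inputs)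
    (hh : GLC.HorizonScaling D.h)
    (hη : GLC.PartitionScaling D.Lf D.h D.η) :
    (∀ R : ℕ, 0 < R → GLC.AlwaysTerminates P D R) ∧
    ∀ w : ℕ → Option (GLC.Signal m),
      (∀ R : ℕ, 0 < R → GLC.IsOutput P D R (w R)) → P.IsSolutionSequence w := by
  refine ⟨fun R _ => GLC.alwaysTerminates P D R, fun w hw =>
    ⟨fun R hR u hu => (hw R hR).mem_Ugoal hu, tendsto_order.2 ⟨fun b hb => ?_, fun b hb => ?_⟩⟩⟩
  · filter_upwards [Filter.eventually_gt_atTop 0] with R hR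
    refine hb.trans_le ?_
    cases hwR : w R with
    | none => exact le_top
    | some u => exact iInf₂_le u ((hw R hR).mem_Ugoal hwR)
  -- A near-optimal `u` suffices; for `c* = ⊤` there is no such `b`.
  · obtain ⟨u, hu, hub⟩ : ∃ u, ∃ _ : u ∈ P.Ugoal, (P.J P.xic u : EReal) < b := by
      simpa only [GLC.Problem.cstar, iInf_lt_iff] using hb
    obtain ⟨err, herr, hcost⟩ := GLC.eventually_cost_le hΩ hfu hLf hM hLg hc hA1 hA2 hA3 hA4
      hinputs hh hη hw hu
    have hlim : Filter.Tendsto (fun R => ((P.J P.xic u + err R : ℝ) : EReal)) Filter.atTop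
        (nhds ((P.J P.xic u : ℝ) : EReal)) := by
      have := herr.const_add (P.J P.xic u)
      rw [add_zero] at this
      exact (continuous_coe_real_ereal.tendsto _).comp this
    filter_upwards [hcost, hlim.eventually (gt_mem_nhds hub)] with R h1 h2
    exact h1.trans_lt h2
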